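/- Let $n\ge 0$ and $\mathbf y=(y_1,\dots,y_n)$ be a vector of positive integers, and put $m=y_1+\cdots+y_n$. Definitions. The Pitman–Stanley polytope is $$\Pi_n(\mathbf y)=\Big\{\mathbf x\in\mathbb R_{\ge 0}^n:\ \sum_{i=1}^k x_i\le\sum_{i=1}^k y_i\ \text{ for } k=1,\dots,n\Big\},$$ and $\operatorname{ehr}_{\Pi_n(\mathbf y)}\in\mathbb R[t]$ is its Ehrhart polynomial, i.e. the unique polynomial with $\operatorname{ehr}_{\Pi_n(\mathbf y)}(t)=|t\,\Pi_n(\mathbf y)\cap\mathbb Z^n|$ for all integers $t\ge 1$. A $\mathbf y$-parking function is a word $w=(w_1,\dots,w_n)$ of positive integers whose weakly increasing rearrangement $b_1\le\cdots\le b_n$ satisfies $b_i\le y_1+\cdots+y_i$ for all $i$. For $l\in\{0,1\}$ consider the following parking protocol with spaces $1,\dots,m$ in a line: if $l=0$ all spaces are available, and if $l=1$ space $1$ is unavailable. Cars $1,\dots,n$ arrive in this order; car $j$ parks in the first space $\ge w_j$ that is available and unoccupied, and it fails to park if there is no such space. Car $j$ is lucky if it parks in space $w_j$. Let $N_{l,i}(\mathbf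 y)$ be the number of $\mathbf y$-parking functions with exactly $i$ lucky cars under this protocol. A polynomial $p\in\mathbb R[t]$ of degree $n$ can be written uniquely as $p(t)=\sum_{i=0}^n c_i\,t^i(1+t)^{n-i}$; it is magic positive if all $c_i\ge 0$. Finally, let $\mathcal I_n$ be the set of $\mathbf s\in\mathbb Z_{\ge 0}^n$ with $\sum_{j=1}^n s_j=n$ and $\sum_{j=1}^i s_j\ge i$ for $i=1,\dots,n$, and for $l\in\{0,1\}$ let $$g_{l}(t)=\sum_{\mathbf s\in\mathcal I_n}\ \prod_{i=1}^n\frac{1}{s_i!}\prod_{j=0}^{s_i-1}\big(y_it+\delta_{i,l}+j\big),$$ where $\delta_{i,l}$ is the Kronecker delta. Theorem. (a) The polynomial $\operatorname{ehr}_{\Pi_n(\mathbf y)}$ exists and is unique, and it has degree $n$. If $\operatorname{ehr}_{\Pi_n(\mathbf y)}(t)=\sum_{i=0}^n c_i\,t^i(1+t)^{n-i}$, then $n!\,c_i=N_{1,i}(\mathbf y)$ for every $0\le i\le n$. In particular all $c_i\ge 0$, so $\operatorname{ehr}_{\Pi_n(\mathbf y)}$ is magic positive. (b) For each $l\in\{0,1\}$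 the polynomial $g_l$ has degree $n$. If $g_l(t)=\sum_{i=0}^n c_i\,t^i(1+t)^{n-i}$, then $n!\,c_i=N_{l,i}(\mathbf y)$ for every $0\le i\le n$. In particular all $c_i\ge 0$, so $g_l$ is magic positive. -/

import Mathlib

open scoped Polynomial Pointwise

/-! ### Polytopes and Ehrhart polynomials -/

/-- The Pitman--Stanley polytope: the points `x ≥ 0` of `ℝⁿ` whose partial sums are bounded by the
partial sums of `y`. -/
def pitmanStanley {n : ℕ} (y : Fin n → ℕ) : Set (Fin n → ℝ) :=
  {x | (∀ i, 0 ≤ x i) ∧ ∀ k, ∑ i ∈ Finset.Iic k, x i ≤ ∑ i ∈ Finset.Iic k, (y i : ℝ)}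

/-- The lattice points of the dilation `t • P`. -/
def latticePoints {n : ℕ} (P : Set (Fin n → ℝ)) (t : ℕ) : Set (Fin n → ℤ) :=
  {z | (fun i => (z i : ℝ)) ∈ (t : ℝ) • P}

/-- `p` interpolates the number of lattice points of the dilations of `P` by positive integers. -/
def IsEhrhartPolynomial {n : ℕ} (P : Set (Fin n → ℝ)) (p : ℝ[X]) : Prop :=
  ∀ t : ℕ, 0 < t → (latticePoints P t).Finite ∧ p.eval (t : ℝ) = ((latticePoints P t).ncard : ℝ)

/-! ### The magic basis -/

/-- `p = ∑ i ≤ d, c i * X ^ i * (1 + X) ^ (d - i)`. -/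
def IsMagicExpansion {d : ℕ} (p : ℝ[X]) (c : Fin (d + 1) → ℝ) : Prop :=
  p = ∑ i : Fin (d + 1),
    Polynomial.C (c i) * Polynomial.X ^ (i : ℕ) * (1 + Polynomial.X) ^ (d - (i : ℕ))

/-- All magic coefficients of `p`, taken with respect to the degree of `p`, are nonnegative. -/
def MagicPositive (p : ℝ[X]) : Prop :=
  ∃ c : Fin (p.natDegree + 1) → ℝ, IsMagicExpansion p c ∧ ∀ i, 0 ≤ c i

/-! ### Parking functions with respect to a vector -/

/-- The words `w` of positive integers whose weakly increasing rearrangement `b` satisfies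
`b i ≤ y 0 + ⋯ + y i` for all `i` (cars and coordinates are indexed from `0`, parking spaces
from `1`). -/
def parkingFunctions {n : ℕ} (y : Fin n → ℕ) : Set (Fin n → ℕ) :=
  {w | (∀ j, 1 ≤ w j) ∧ ∀ i, (w ∘ Tuple.sort w) i ≤ ∑ j ∈ Finset.Iic i, y j}

/-- There are finitely many of them, so that counting them with `Set.ncard` makes sense. -/
theorem parkingFunctions_finite {n : ℕ} (y : Fin n → ℕ) : (parkingFunctions y).Finite := by
  refine (Set.finite_Iic (fun _ : Fin n => ∑ j, y j)).subset fun w hw i => ?_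
  have h := hw.2 ((Tuple.sort w).symm i)
  simp only [Function.comp_apply, Equiv.apply_symm_apply] at h
  exact h.trans (Finset.sum_le_sum_of_subset (Finset.subset_univ _))

/-! ### The linear parking protocol -/

/-- The space taken by a car with preference `p` when the spaces are `1, …, m` and those in `U` are
occupied or unavailable: the first free space from `p` on, or `none` if there is none. -/
def parkCar (m : ℕ) (U : Finset ℕ) (p : ℕ) : Option ℕ :=
  if h : (Finset.Icc p m \ U).Nonempty then some ((Finset.Icc p m \ U).min' h) else none

/-- The spaces that are occupied or unavailable after the first `j` cars have arrived. For `l = 1`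
the first space is unavailable from the beginning, for `l = 0` all spaces are available. -/
def blocked (m : ℕ) (l : Fin 2) {r : ℕ} (w : Fin r → ℕ) : ℕ → Finset ℕ
  | 0 => if l = 1 then {1} else ∅
  | j + 1 =>
    if h : j < r then
      blocked m l w j ∪ (parkCar m (blocked m l w j) (w ⟨j, h⟩)).toFinset
    else blocked m l w j

/-- The space in which car `j` parks (`none` if it fails to park). -/
def parkingOut (m : ℕ) (l : Fin 2) {r : ℕ} (w : Fin r → ℕ) (j : Fin r) : Option ℕ :=
  parkCar m (blocked m l w j) (w j)

/-- The lucky cars: those that park in their preferred space. -/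
def luckySet (m : ℕ) (l : Fin 2) {r : ℕ} (w : Fin r → ℕ) : Finset (Fin r) :=
  Finset.univ.filter fun j => parkingOut m l w j = some (w j)

/-- The parking functions for `y` with exactly `i` lucky cars, in `m = ∑ j, y j` spaces. -/
def parkingFunctionsWithLucky {n : ℕ} (y : Fin n → ℕ) (l : Fin 2) (i : ℕ) : Set (Fin n → ℕ) :=
  {w | w ∈ parkingFunctions y ∧ (luckySet (∑ j, y j) l w).card = i}

/-! ### The polynomials attached to the two protocols -/

/-- Weak compositions of `n` into `n` parts that dominate `(1, …, 1)`. -/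
def dominatingCompositions (n : ℕ) : Finset (Fin n → ℕ) :=
  (Finset.piAntidiag Finset.univ n).filter
    fun s => ∀ i : Fin n, (i : ℕ) + 1 ≤ ∑ j ∈ Finset.Iic i, s j

/-- The multiset binomial coefficient `a (a + 1) ⋯ (a + k - 1) / k!` of a polynomial `a`. -/
noncomputable def multisetBinomial (a : ℝ[X]) (k : ℕ) : ℝ[X] :=
  Polynomial.C ((k.factorial : ℝ)⁻¹) * ∏ j ∈ Finset.range k, (a + Polynomial.C (j : ℝ))

/-- `∑ s, ∏ i, ((y i * t + δ, s i))`, the sum being over the compositions that dominate `(1, …, 1)`,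
where `δ = 1` for the first index if `l = 1`, and `δ = 0` otherwise. -/
noncomputable def parkingPolynomial {n : ℕ} (y : Fin n → ℕ) (l : Fin 2) : ℝ[X] :=
  ∑ s ∈ dominatingCompositions n, ∏ i : Fin n,
    multisetBinomial
      (Polynomial.C (y i : ℝ) * Polynomial.X + (if (i : ℕ) + 1 = (l : ℕ) then 1 else 0)) (s i)

/-! Let `Y k` be the partial sums of `y`, continued by ones, and let `a i` be the linear polynomial
of block `i`, so that the first `k + 1` blocks sum to `Y (k + 1) * X + l`. The sums `D k =
dominatingSum a k k`, the parking sums and the lattice point counts all solve the same kind of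
unitriangular linear system, hence agree (`eq_of_triangular`).

For `D`: by Vandermonde, the multiset coefficient of `∑ i < K, a i` over `n` sums over all
compositions of `n` into `K` parts. If `n < K`, none dominates. At the first failing index `k` the
earlier parts dominate with total exactly `k` and part `k` is `0`, which leaves `D k` times a
multiset coefficient of the later blocks (`multisetBinomial_sum_range_of_lt`).

For parking: let every word over `[1, Y K]` park, overflowing cars being sent to the last free
space. A car that finds `u` of `M` spaces taken contributes `u (1 + X) + (M - u) X = M X + u`, so
the weights of all words sum to a rising factorial (`wordSum_wordWeight`). Each word has a unique
`k` for which its letters at most `Y (k + 1)` form a parking word of length `k`. These cars and the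
others do not interact (`wordWeight_union`), and shuffling the two subwords gives binomial
coefficients. Thus the parking sums divided by `k!` satisfy the system for `D`, an unavailable first
space accounting for `l`; so `n! * D n` sums `X ^ lucky * (1 + X) ^ unlucky` over parking functions.

For the polytope: partial sums turn lattice points into weakly increasing sequences under the
staircase `t * Y k`. Cutting an arbitrary weakly increasing sequence where it first leaves the
staircase yields the system for `l = 1`, evaluated at `t`. -/

/-! ### Multiset binomial coefficients -/

theorem multisetBinomial_zero_right (a : ℝ[X]) : multisetBinomial a 0 = 1 := by
  simp [multisetBinomial]

theorem multisetBinomial_zero_left {k : ℕ} (hk : k ≠ 0) : multisetBinomial 0 k = 0 := by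
  rw [multisetBinomial, Finset.prod_eq_zero (Finset.mem_range.2 (Nat.pos_of_ne_zero hk))]
  · simp
  · simp

theorem factorial_mul_multisetBinomial (a : ℝ[X]) (k : ℕ) :
    (k.factorial : ℝ[X]) * multisetBinomial a k = ∏ j ∈ Finset.range k, (a + (j : ℝ[X])) := by
  rw [multisetBinomial, ← mul_assoc, ← Polynomial.C_eq_natCast, ← Polynomial.C_mul,
    mul_inv_cancel₀ (by exact_mod_cast k.factorial_ne_zero)]
  simp

/-- The rising factorials are a sequence of binomial type. -/
theorem prod_range_add_natCast_add {R : Type*} [CommRing R] (a b : R) (n : ℕ) :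
    ∏ j ∈ Finset.range n, (a + b + (j : R)) = ∑ ij ∈ Finset.HasAntidiagonal.antidiagonal n,
      (n.choose ij.1 : R) * ((∏ j ∈ Finset.range ij.1, (a + (j : R))) *
        ∏ j ∈ Finset.range ij.2, (b + (j : R))) := by
  induction n with
  | zero => simp
  | succ n ih =>
    rw [Finset.prod_range_succ, ih, Finset.sum_antidiagonal_choose_succ_mul
      (fun p q => (∏ j ∈ Finset.range p, (a + (j : R))) * ∏ j ∈ Finset.range q, (b + (j : R))),
      ← Finset.sum_add_distrib, Finset.sum_mul]
    -- With `i + j = n` the new factor `a + b + n` is `(a + i) + (b + j)`; each summand extends one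
    -- of the two products.
    refine Finset.sum_congr rfl fun ij h => ?_
    have h := Finset.HasAntidiagonal.mem_antidiagonal.1 h
    rw [← Nat.choose_symm_of_eq_add (show n = ij.1 + ij.2 from h.symm), Finset.prod_range_succ,
      Finset.prod_range_succ, ← h]
    push_cast
    ring

theorem factorial_ne_zero_polynomial (k : ℕ) : (k.factorial : ℝ[X]) ≠ 0 := by
  exact_mod_cast k.factorial_ne_zero

/-- Vandermonde's identity for multiset binomial coefficients. -/
theorem multisetBinomial_add (a b : ℝ[X]) (n : ℕ) :
    multisetBinomial (a + b) n = ∑ ij ∈ Finset.HasAntidiagonal.antidiagonal n,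
      multisetBinomial a ij.1 * multisetBinomial b ij.2 := by
  apply mul_left_cancel₀ (factorial_ne_zero_polynomial n)
  rw [factorial_mul_multisetBinomial, prod_range_add_natCast_add, Finset.mul_sum]
  refine Finset.sum_congr rfl fun ij h => ?_
  have h := Finset.HasAntidiagonal.mem_antidiagonal.1 h
  rw [← factorial_mul_multisetBinomial, ← factorial_mul_multisetBinomial, ← h,
    ← Nat.add_choose_mul_factorial_mul_factorial,
    Nat.choose_symm_add]
  push_cast
  ring

/-! ### Sums over dominating compositions -/

/-- `s` has all partial sums at least those of `(1, …, 1)`. -/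
def Dominating {k : ℕ} (s : Fin k → ℕ) : Prop :=
  ∀ i : Fin k, (i : ℕ) + 1 ≤ ∑ j ∈ Finset.Iic i, s j

theorem Fin.sum_Iic_last {M : Type*} [AddCommMonoid M] {k : ℕ} (f : Fin (k + 1) → M) :
    ∑ j ∈ Finset.Iic (Fin.last k), f j = ∑ j, f j := by
  congr 1
  ext j
  simp [Fin.le_last]

theorem Fin.sum_Iic_eq_sum_range {M : Type*} [AddCommMonoid M] {k : ℕ} (f : ℕ → M) (i : Fin k) :
    ∑ j ∈ Finset.Iic i, f (j : ℕ) = ∑ j ∈ Finset.range ((i : ℕ) + 1), f j := by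
  refine Finset.sum_bij (fun j _ => (j : ℕ)) ?_ ?_ ?_ ?_
  · intro j hj
    have := Finset.mem_Iic.1 hj
    simpa [Nat.lt_succ_iff] using this
  · intro a _ b _ h
    exact Fin.ext h
  · intro b hb
    have hb := Finset.mem_range.1 hb
    exact ⟨⟨b, by omega⟩, Finset.mem_Iic.2 (Fin.le_def.2 (by simp; omega)), rfl⟩
  · intros
    rfl

open Classical in
/-- The sum of `∏ i, h (a i) (s i)` over the dominating `s` with `k` parts and total `j`. -/
noncomputable def dominatingSum (a : ℕ → ℝ[X]) (k j : ℕ) : ℝ[X] :=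
  ∑ s ∈ (Finset.piAntidiag (Finset.univ : Finset (Fin k)) j).filter Dominating,
    ∏ i : Fin k, multisetBinomial (a i) (s i)

theorem dominatingSum_zero (a : ℕ → ℝ[X]) (j : ℕ) :
    dominatingSum a 0 j = if j = 0 then 1 else 0 := by
  classical
  rw [dominatingSum]
  rcases eq_or_ne j 0 with rfl | hj
  · rw [Finset.filter_true_of_mem (fun s _ i => i.elim0)]
    simp
  · rw [Finset.univ_eq_empty, Finset.piAntidiag_empty_of_ne_zero hj]
    simp [hj]

theorem dominating_snoc {k : ℕ} (s : Fin (k + 1) → ℕ) :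
    Dominating s ↔ Dominating (fun i : Fin k => s i.castSucc) ∧ k + 1 ≤ ∑ j, s j := by
  simp only [Dominating, Fin.forall_fin_succ', Fin.sum_Iic_castSucc, Fin.sum_Iic_last]
  simp

/-- Split off the last part: the only condition it adds to domination is on the total, which is
prescribed to be `j`. -/
theorem dominatingSum_succ (a : ℕ → ℝ[X]) (k j : ℕ) :
    dominatingSum a (k + 1) j = if k + 1 ≤ j then ∑ pq ∈ Finset.HasAntidiagonal.antidiagonal j,
      dominatingSum a k pq.1 * multisetBinomial (a k) pq.2 else 0 := by
  classical
  split_ifs with hj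
  · simp only [dominatingSum, Finset.sum_mul]
    rw [Finset.sum_sigma']
    refine Finset.sum_bij' (fun s _ => ⟨(∑ i : Fin k, s i.castSucc, s (Fin.last k)),
      fun i => s i.castSucc⟩) (fun x _ => Fin.snoc x.2 x.1.2) ?_ ?_ ?_ ?_ ?_
    · intro s hs
      simp only [Finset.mem_filter, Finset.mem_piAntidiag, dominating_snoc,
        Fin.sum_univ_castSucc] at hs
      simp only [Finset.mem_sigma, Finset.mem_filter, Finset.mem_piAntidiag,
        Finset.HasAntidiagonal.mem_antidiagonal]
      exact ⟨hs.1.1, ⟨trivial, by simp⟩, hs.2.1⟩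
    · rintro ⟨⟨p, q⟩, s⟩ hs
      simp only [Finset.mem_sigma, Finset.mem_filter, Finset.mem_piAntidiag,
        Finset.HasAntidiagonal.mem_antidiagonal] at hs
      simp only [Finset.mem_filter, Finset.mem_piAntidiag, dominating_snoc, Fin.snoc_castSucc,
        Fin.sum_univ_castSucc, Fin.snoc_last]
      refine ⟨⟨?_, by simp⟩, hs.2.2, ?_⟩ <;> rw [hs.2.1.1, hs.1]
      exact hj
    · intro s _
      refine funext fun i => Fin.lastCases ?_ (fun i => ?_) i <;> simp
    · rintro ⟨⟨p, q⟩, s⟩ hs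
      simp only [Finset.mem_sigma, Finset.mem_filter, Finset.mem_piAntidiag,
        Finset.HasAntidiagonal.mem_antidiagonal] at hs
      simp only [Fin.snoc_castSucc, Fin.snoc_last, hs.2.1.1]
    · intro s _
      simp [Fin.prod_univ_castSucc]
  · rw [dominatingSum, Finset.filter_false_of_mem, Finset.sum_empty]
    intro s hs h
    rw [Finset.mem_piAntidiag] at hs
    rw [dominating_snoc, hs.1] at h
    exact hj h.2

theorem dominatingSum_eq_zero_of_lt (a : ℕ → ℝ[X]) {k j : ℕ} (h : j < k) :
    dominatingSum a k j = 0 := by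
  cases k with
  | zero => omega
  | succ k => rw [dominatingSum_succ, if_neg (by omega)]

/-- Decomposition of all compositions by the first index at which they fail to dominate. -/
theorem multisetBinomial_sum_range (a : ℕ → ℝ[X]) (k j : ℕ) :
    multisetBinomial (∑ i ∈ Finset.range k, a i) j = dominatingSum a k j +
      ∑ i ∈ Finset.range k, if i ≤ j then dominatingSum a i i *
        multisetBinomial (∑ r ∈ Finset.Ico (i + 1) k, a r) (j - i) else 0 := by
  induction k generalizing j with
  | zero =>
    rw [dominatingSum_zero]
    split_ifs with h
    · simp [h, multisetBinomial_zero_right]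
    · simp [multisetBinomial_zero_left h]
  | succ k ih =>
    -- A failure at `i < k` is unaffected by a new last block, which only joins the tail through
    -- Vandermonde.
    have key (i : ℕ) (hi : i < k) : (if i ≤ j then dominatingSum a i i *
        multisetBinomial (∑ r ∈ Finset.Ico (i + 1) (k + 1), a r) (j - i) else 0) =
        ∑ pq ∈ Finset.HasAntidiagonal.antidiagonal j, (if i ≤ pq.1 then dominatingSum a i i *
          multisetBinomial (∑ r ∈ Finset.Ico (i + 1) k, a r) (pq.1 - i) else 0) *
          multisetBinomial (a k) pq.2 := by
      split_ifs with h
      · obtain ⟨d, rfl⟩ := Nat.exists_eq_add_of_le h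
        rw [Finset.sum_Ico_succ_top (by omega), multisetBinomial_add, Nat.add_sub_cancel_left,
          Finset.mul_sum]
        rw [← Finset.sum_filter_add_sum_filter_not (Finset.HasAntidiagonal.antidiagonal (i + d))
          (fun pq => i ≤ pq.1)]
        rw [Finset.sum_eq_zero (s := Finset.filter (fun pq : ℕ × ℕ => ¬ i ≤ pq.1) _)
          (fun pq h => by rw [if_neg (Finset.mem_filter.1 h).2, zero_mul]), add_zero]
        refine Finset.sum_bij' (fun pq _ => (i + pq.1, pq.2)) (fun pq _ => (pq.1 - i, pq.2))
          ?_ ?_ ?_ ?_ ?_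
        all_goals
          rintro ⟨p, q⟩ h
          simp only [Finset.mem_filter, Finset.HasAntidiagonal.mem_antidiagonal, Prod.mk.injEq] at *
        · omega
        · omega
        · simp
        · exact ⟨by omega, trivial⟩
        · simp [mul_assoc]
      · refine (Finset.sum_eq_zero fun pq hpq => ?_).symm
        have := Finset.HasAntidiagonal.mem_antidiagonal.1 hpq
        rw [if_neg (by omega), zero_mul]
    rw [Finset.sum_range_succ, multisetBinomial_add, Finset.sum_range_succ,
      Finset.sum_congr rfl fun i hi => key i (Finset.mem_range.1 hi), Finset.sum_comm]
    simp only [ih, add_mul, Finset.sum_add_distrib, Finset.sum_mul]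
    rw [add_comm (∑ y ∈ Finset.HasAntidiagonal.antidiagonal j, _) (ite _ _ _), ← add_assoc]
    congr 1
    -- The new term `i = k` has an empty tail and matters only for `j = k`: it then collects the
    -- compositions that dominate on the first `k` parts and end in `0`.
    rw [dominatingSum_succ, Finset.Ico_self, Finset.sum_empty]
    split_ifs with h1 h2 h2
    · rw [multisetBinomial_zero_left (by omega), mul_zero, add_zero]
    · omega
    · obtain rfl : k = j := by omega
      rw [Nat.sub_self, multisetBinomial_zero_right, zero_add, mul_one,
        Finset.sum_eq_single (k, 0)]
      · rw [multisetBinomial_zero_right, mul_one]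
      · rintro ⟨p, q⟩ hpq hne
        have := Finset.HasAntidiagonal.mem_antidiagonal.1 hpq
        rw [dominatingSum_eq_zero_of_lt, zero_mul]
        simp only [ne_eq, Prod.mk.injEq, not_and] at hne this
        show p < k
        by_contra hp
        exact hne (by omega) (by omega)
      · simp
    · rw [add_zero]
      refine Finset.sum_eq_zero fun pq hpq => ?_
      have := Finset.HasAntidiagonal.mem_antidiagonal.1 hpq
      rw [dominatingSum_eq_zero_of_lt a (by omega), zero_mul]

/-- The instance of the decomposition in which no composition is dominating. -/
theorem multisetBinomial_sum_range_of_lt (a : ℕ → ℝ[X]) {k n : ℕ} (h : n < k) :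
    multisetBinomial (∑ i ∈ Finset.range k, a i) n = ∑ i ∈ Finset.range (n + 1),
      dominatingSum a i i * multisetBinomial (∑ r ∈ Finset.Ico (i + 1) k, a r) (n - i) := by
  rw [multisetBinomial_sum_range, dominatingSum_eq_zero_of_lt a h, zero_add, ← Finset.sum_filter]
  refine Finset.sum_congr ?_ fun _ _ => rfl
  ext i
  simp only [Finset.mem_filter, Finset.mem_range]
  omega

/-- Triangular systems with unit diagonal have at most one solution. -/
theorem eq_of_triangular {R : Type*} [Ring R] {N : ℕ} {A B : ℕ → R} (κ : ℕ → ℕ → R)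
    (hκ : ∀ n, κ n n = 1)
    (h : ∀ n ≤ N, ∑ i ∈ Finset.range (n + 1), A i * κ i n =
      ∑ i ∈ Finset.range (n + 1), B i * κ i n) {n : ℕ} (hn : n ≤ N) : A n = B n := by
  induction n using Nat.strong_induction_on with
  | _ n ih =>
    have := h n hn
    rw [Finset.sum_range_succ, Finset.sum_range_succ, hκ, mul_one, mul_one,
      Finset.sum_congr rfl fun i hi => by
        rw [ih i (Finset.mem_range.1 hi) ((Finset.mem_range.1 hi).le.trans hn)]] at this
    exact add_left_cancel this

/-! ### Sums over words -/

/-- The sum of `f` over the words of length `n` over the alphabet `A`. -/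
def wordSum {R : Type*} [AddCommMonoid R] (A : Finset ℕ) : ℕ → (List ℕ → R) → R
  | 0, f => f []
  | n + 1, f => ∑ a ∈ A, wordSum A n fun w => f (a :: w)

section wordSum

variable {R : Type*} [CommRing R] {A : Finset ℕ}

theorem wordSum_congr {n : ℕ} {f g : List ℕ → R}
    (h : ∀ w, w.length = n → (∀ p ∈ w, p ∈ A) → f w = g w) : wordSum A n f = wordSum A n g := by
  induction n generalizing f g with
  | zero => exact h [] rfl (by simp)
  | succ n ih =>
    refine Finset.sum_congr rfl fun a ha => ih fun w hw hA => h _ (by simp [hw]) ?_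
    simpa [ha] using hA

theorem wordSum_mul_left (n : ℕ) (c : R) (f : List ℕ → R) :
    wordSum A n (fun w => c * f w) = c * wordSum A n f := by
  induction n generalizing f with
  | zero => rfl
  | succ n ih => simp only [wordSum, ih, Finset.mul_sum]

theorem wordSum_sum {ι : Type*} (s : Finset ι) (n : ℕ) (f : ι → List ℕ → R) :
    wordSum A n (fun w => ∑ i ∈ s, f i w) = ∑ i ∈ s, wordSum A n (f i) := by
  induction n generalizing f with
  | zero => rfl
  | succ n ih =>
    simp only [wordSum, ih]
    exact Finset.sum_comm

/-- A sum over words of products of functions of two complementary subwords. -/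
theorem wordSum_shuffle (P : ℕ → Prop) [DecidablePred P] (n : ℕ) (f g : List ℕ → R) :
    wordSum A n (fun w => f (w.filter (fun p => P p)) * g (w.filter (fun p => ¬ P p))) =
      ∑ ij ∈ Finset.HasAntidiagonal.antidiagonal n, (n.choose ij.1 : R) *
        (wordSum (A.filter P) ij.1 f * wordSum (A.filter fun p => ¬ P p) ij.2 g) := by
  induction n generalizing f g with
  | zero => simp [wordSum]
  | succ n ih =>
    rw [Finset.sum_antidiagonal_choose_succ_mul
      (fun p q => wordSum (A.filter P) p f * wordSum (A.filter fun p => ¬ P p) q g)]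
    simp only [wordSum]
    -- The first letter lengthens one of the two subwords; these cases are the two sums in Pascal's
    -- rule.
    rw [← Finset.sum_filter_add_sum_filter_not A P, add_comm]
    congr 1
    · refine (Finset.sum_congr rfl fun a ha => (congrArg (wordSum A n) (funext fun w => ?_)).trans
        (ih f fun w => g (a :: w))).trans ?_
      · rw [List.filter_cons_of_neg (by simpa using (Finset.mem_filter.1 ha).2),
          List.filter_cons_of_pos (by simpa using (Finset.mem_filter.1 ha).2)]
      · rw [Finset.sum_comm]
        simp only [Finset.mul_sum]
    · refine (Finset.sum_congr rfl fun a ha => (congrArg (wordSum A n) (funext fun w => ?_)).trans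
        (ih (fun w => f (a :: w)) g)).trans ?_
      · rw [List.filter_cons_of_pos (by simpa using (Finset.mem_filter.1 ha).2),
          List.filter_cons_of_neg (by simpa using (Finset.mem_filter.1 ha).2)]
      · rw [Finset.sum_comm]
        refine Finset.sum_congr rfl fun ij h => ?_
        rw [← Nat.choose_symm_of_eq_add (Finset.HasAntidiagonal.mem_antidiagonal.1 h).symm,
          Finset.sum_mul, Finset.mul_sum]

theorem wordSum_eq_sum_piFinset (n : ℕ) (f : List ℕ → R) :
    wordSum A n f = ∑ w ∈ Fintype.piFinset (fun _ : Fin n => A), f (List.ofFn w) := by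
  induction n generalizing f with
  | zero => simp [wordSum]
  | succ n ih =>
    simp only [wordSum, ih]
    rw [Finset.sum_sigma']
    refine Finset.sum_bij' (fun x _ => Fin.cons x.1 x.2) (fun w _ => ⟨w 0, Fin.tail w⟩)
      ?_ ?_ ?_ ?_ ?_
    · rintro ⟨a, w⟩ h
      simp only [Finset.mem_sigma, Fintype.mem_piFinset] at h ⊢
      exact Fin.cases h.1 (fun i => by simpa using h.2 i)
    · intro w h
      simp only [Finset.mem_sigma, Fintype.mem_piFinset] at h ⊢
      exact ⟨h 0, fun i => h _⟩
    · rintro ⟨a, w⟩ h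
      simp
    · intro w h
      simp
    · rintro ⟨a, w⟩ h
      simp [List.ofFn_succ]

end wordSum

/-! ### A parking protocol in which every car parks -/

/-- The space for a car with preference `p` when the spaces are `1, …, M` and those in `U` are not
free: the first free space from `p` on if there is one, and the last free space otherwise. -/
def parkInside (M : ℕ) (U : Finset ℕ) (p : ℕ) : ℕ :=
  if h : (Finset.Icc p M \ U).Nonempty then (Finset.Icc p M \ U).min' h
  else if h : (Finset.Icc 1 M \ U).Nonempty then (Finset.Icc 1 M \ U).max' h else 0

/-- The free space `r` rules out the default value `0`. The disjunction separates normal parking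
from overflow. -/
theorem parkInside_spec {M p r : ℕ} {U : Finset ℕ} (hp : 1 ≤ p) (hr : r ∈ Finset.Icc 1 M)
    (hrU : r ∉ U) : parkInside M U p ∈ Finset.Icc 1 M ∧ parkInside M U p ∉ U ∧
      ((p ≤ parkInside M U p ∧ ∀ x, p ≤ x → x < parkInside M U p → x ∈ U) ∨
        ((∀ x, p ≤ x → x ≤ M → x ∈ U) ∧ ∀ x, parkInside M U p < x → x ≤ M → x ∈ U)) := by
  unfold parkInside
  split_ifs with h h'
  · have h1 := Finset.min'_mem _ h
    have h2 : ∀ x ∈ Finset.Icc p M \ U, (Finset.Icc p M \ U).min' h ≤ x :=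
      fun x hx => Finset.min'_le _ x hx
    generalize (Finset.Icc p M \ U).min' h = s at h1 h2
    simp only [Finset.mem_sdiff, Finset.mem_Icc] at h1 h2 ⊢
    refine ⟨by omega, h1.2, Or.inl ⟨h1.1.1, fun x h3 h4 => ?_⟩⟩
    by_contra hx
    have := h2 x ⟨by omega, hx⟩
    omega
  · have h1 := Finset.max'_mem _ h'
    have h2 : ∀ x ∈ Finset.Icc 1 M \ U, x ≤ (Finset.Icc 1 M \ U).max' h' :=
      fun x hx => Finset.le_max' _ x hx
    generalize (Finset.Icc 1 M \ U).max' h' = s at h1 h2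
    simp only [Finset.mem_sdiff, Finset.mem_Icc] at h1 h2 ⊢
    refine ⟨by omega, h1.2, Or.inr ⟨fun x h3 h4 => ?_, fun x h3 h4 => ?_⟩⟩
    · by_contra hx
      exact h ⟨x, by simp [h3, h4, hx]⟩
    · by_contra hx
      have := h2 x ⟨by omega, hx⟩
      omega
  · exact (h' ⟨r, by simpa using ⟨by simpa using hr, hrU⟩⟩).elim

theorem parkInside_eq_of_first {M p s : ℕ} {U : Finset ℕ} (hp : 1 ≤ p) (hps : p ≤ s) (hsM : s ≤ M)
    (hs : s ∉ U) (h : ∀ x, p ≤ x → x < s → x ∈ U) : parkInside M U p = s := by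
  obtain ⟨h1, h2, h3 | h3⟩ := parkInside_spec (M := M) hp (Finset.mem_Icc.2 ⟨hp.trans hps, hsM⟩) hs
  · rcases lt_trichotomy (parkInside M U p) s with h4 | h4 | h4
    · exact (h2 (h _ h3.1 h4)).elim
    · exact h4
    · exact (hs (h3.2 _ hps h4)).elim
  · exact (hs (h3.1 _ hps hsM)).elim

theorem parkInside_eq_of_last {M p s : ℕ} {U : Finset ℕ} (hp : 1 ≤ p) (hs1 : 1 ≤ s) (hsM : s ≤ M)
    (hs : s ∉ U) (h : ∀ x, p ≤ x → x ≤ M → x ∈ U) (h' : ∀ x, s < x → x ≤ M → x ∈ U) :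
    parkInside M U p = s := by
  obtain ⟨h1, h2, h3⟩ := parkInside_spec (M := M) hp (Finset.mem_Icc.2 ⟨hs1, hsM⟩) hs
  rw [Finset.mem_Icc] at h1
  rcases h3 with h3 | h3
  · exact (h2 (h _ h3.1 h1.2)).elim
  · rcases lt_trichotomy (parkInside M U p) s with h4 | h4 | h4
    · exact (hs (h3.2 _ h4 hsM)).elim
    · exact h4
    · exact (h2 (h' _ h4 h1.2)).elim

/-- The product over the cars of a word of `X` if the car parks in its preferred space and `1 + X`
otherwise, when the set `U` of unavailable spaces evolves by `step`. -/
noncomputable def wordWeight (step : Finset ℕ → ℕ → Finset ℕ) : Finset ℕ → List ℕ → ℝ[X]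
  | _, [] => 1
  | U, p :: w => (if p ∈ U then 1 + Polynomial.X else Polynomial.X) * wordWeight step (step U p) w

/-- The evolution of the unavailable spaces for `parkInside`. -/
def stepInside (M : ℕ) (U : Finset ℕ) (p : ℕ) : Finset ℕ := insert (parkInside M U p) U

theorem exists_free {B M : ℕ} {U : Finset ℕ} (h : U.card < M - B) :
    ∃ r ∈ Finset.Ioc B M, r ∉ U := by
  by_contra! hc
  have := Finset.card_le_card (show Finset.Ioc B M ⊆ U from fun r hr => hc r hr)
  rw [Nat.card_Ioc] at this
  omega

/-- This is why overflow goes to the last free space: while `(B, M]` has room, that space lies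
there, so cars of the upper block never enter the lower one. -/
theorem parkInside_mem_Ioc {B M p : ℕ} {U : Finset ℕ} (h : U.card < M - B) (hp : B < p) :
    parkInside M U p ∈ Finset.Ioc B M ∧ parkInside M U p ∉ U := by
  obtain ⟨r, hr, hrU⟩ := exists_free h
  rw [Finset.mem_Ioc] at hr
  obtain ⟨h1, h2, h3⟩ := parkInside_spec (M := M) (p := p) (by omega)
    (Finset.mem_Icc.2 ⟨by omega, hr.2⟩) hrU
  refine ⟨?_, h2⟩
  rw [Finset.mem_Icc] at h1
  rw [Finset.mem_Ioc]
  refine ⟨?_, h1.2⟩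
  rcases h3 with h3 | h3
  · omega
  · by_contra hc
    exact hrU (h3.2 r (by omega) hr.2)

/-- All words over the interval `(B, M]` together have a product formula. -/
theorem wordSum_wordWeight (B M m : ℕ) (U : Finset ℕ) (hU : U ⊆ Finset.Ioc B M)
    (h : U.card + m ≤ M - B) :
    wordSum (Finset.Ioc B M) m (wordWeight (stepInside M) U) =
      ∏ i ∈ Finset.range m,
        (((M - B : ℕ) : ℝ[X]) * Polynomial.X + (U.card : ℝ[X]) + (i : ℝ[X])) := by
  induction m generalizing U with
  | zero => simp [wordSum, wordWeight]
  | succ m ih =>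
    simp only [wordSum, wordWeight, wordSum_mul_left]
    rw [Finset.prod_range_succ']
    have key : ∀ p ∈ Finset.Ioc B M, wordSum (Finset.Ioc B M) m
        (wordWeight (stepInside M) (stepInside M U p)) = ∏ i ∈ Finset.range m,
          (((M - B : ℕ) : ℝ[X]) * Polynomial.X + (U.card : ℝ[X]) + ((i + 1 : ℕ) : ℝ[X])) := by
      intro p hp
      obtain ⟨h1, h2⟩ := parkInside_mem_Ioc (show U.card < M - B by omega) (Finset.mem_Ioc.1 hp).1
      have hc : (stepInside M U p).card = U.card + 1 := Finset.card_insert_of_notMem h2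
      rw [ih (stepInside M U p) (Finset.insert_subset h1 hU) (by omega), hc]
      refine Finset.prod_congr rfl fun i _ => ?_
      push_cast
      ring
    rw [Finset.sum_congr rfl fun p hp => by rw [key p hp], ← Finset.sum_mul, mul_comm]
    congr 1
    -- The first car is unlucky for `U.card` of the `M - B` preferences, and the factor of the
    -- remaining cars depends only on the number of taken spaces.
    rw [Finset.sum_ite, Finset.sum_const, Finset.sum_const, Finset.filter_mem_eq_inter,
      Finset.inter_eq_right.2 hU, Finset.filter_notMem_eq_sdiff, Finset.card_sdiff_of_subset hU,
      Nat.card_Ioc, nsmul_eq_mul, nsmul_eq_mul, Nat.cast_sub (by omega)]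
    push_cast
    ring

/-! ### Words that park in an initial interval -/

/-- Hall's condition for the cars of `w` to park in `[1, B]` when the spaces in `U` are
unavailable. -/
def Fits (B : ℕ) (U : Finset ℕ) (w : List ℕ) : Prop :=
  ∀ c < B, (Finset.Ioc c B ∩ U).card + w.countP (fun p => c < p) + c ≤ B

theorem Fits.exists_free {B p : ℕ} {U : Finset ℕ} {w : List ℕ} (h : Fits B U (p :: w))
    (hp : 1 ≤ p) (hpB : p ≤ B) : ∃ r, p ≤ r ∧ r ≤ B ∧ r ∉ U := by
  have h1 := h (p - 1) (by omega)
  rw [List.countP_cons_of_pos (by simp; omega)] at h1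
  by_contra! hc
  have := Finset.card_le_card (show Finset.Ioc (p - 1) B ⊆ Finset.Ioc (p - 1) B ∩ U from
    fun r hr => Finset.mem_inter.2 ⟨hr, hc r (by have := Finset.mem_Ioc.1 hr; omega)
      (Finset.mem_Ioc.1 hr).2⟩)
  rw [Nat.card_Ioc] at this
  omega

/-- For `c < p` the new taken space is paid for by the departed car, and for `s ≤ c` nothing
changes. For `p ≤ c < s` the spaces `p, …, c` are all taken, so the old condition at `p - 1` implies
the new one at `c`. -/
theorem Fits.insert_first {B p s : ℕ} {U : Finset ℕ} {w : List ℕ} (h : Fits B U (p :: w))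
    (hp : 1 ≤ p) (hps : p ≤ s) (hfirst : ∀ x, p ≤ x → x < s → x ∈ U) :
    Fits B (insert s U) w := by
  intro c hc
  have h0 := h c hc
  have hins : (Finset.Ioc c B ∩ insert s U).card ≤ (Finset.Ioc c B ∩ U).card + 1 := by
    refine (Finset.card_le_card (t := insert s (Finset.Ioc c B ∩ U)) fun x hx => ?_).trans
      (Finset.card_insert_le _ _)
    simp only [Finset.mem_inter, Finset.mem_insert] at hx ⊢
    tauto
  rcases lt_or_ge c p with hcp | hcp
  · rw [List.countP_cons_of_pos (by simpa using hcp)] at h0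
    omega
  rw [List.countP_cons_of_neg (by simpa using hcp)] at h0
  rcases le_or_gt s c with hsc | hsc
  · have : Finset.Ioc c B ∩ insert s U = Finset.Ioc c B ∩ U := by
      ext x
      simp only [Finset.mem_inter, Finset.mem_insert, Finset.mem_Ioc]
      constructor
      · rintro ⟨h1, rfl | h2⟩
        · omega
        · exact ⟨h1, h2⟩
      · tauto
    rw [this]
    exact h0
  · have h1 := h (p - 1) (by omega)
    rw [List.countP_cons_of_pos (by simp; omega)] at h1
    have h2 : w.countP (fun q => c < q) ≤ w.countP (fun q => p - 1 < q) :=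
      List.countP_mono_left fun q _ hq => by simp at hq ⊢; omega
    have h3 : (Finset.Ioc (p - 1) c).card + (Finset.Ioc c B ∩ U).card ≤
        (Finset.Ioc (p - 1) B ∩ U).card := by
      rw [← Finset.card_union_of_disjoint]
      · refine Finset.card_le_card fun x hx => ?_
        simp only [Finset.mem_union, Finset.mem_inter, Finset.mem_Ioc] at hx ⊢
        rcases hx with hx | hx
        · exact ⟨by omega, hfirst x (by omega) (by omega)⟩
        · exact ⟨by omega, hx.2⟩
      · rw [Finset.disjoint_left]
        intro x hx
        simp only [Finset.mem_inter, Finset.mem_Ioc] at hx ⊢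
        omega
    rw [Nat.card_Ioc] at h3
    omega

theorem Fits.parkInside {B M p : ℕ} {U : Finset ℕ} {w : List ℕ} (h : Fits B U (p :: w))
    (hp : 1 ≤ p) (hpB : p ≤ B) (hBM : B ≤ M) :
    p ≤ parkInside M U p ∧ parkInside M U p ≤ B ∧ parkInside M U p ∉ U ∧
      (∀ x, p ≤ x → x < parkInside M U p → x ∈ U) ∧ Fits B (stepInside M U p) w := by
  obtain ⟨r, hpr, hrB, hrU⟩ := h.exists_free hp hpB
  obtain ⟨h1, h2, h3 | h3⟩ := parkInside_spec (M := M) hp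
    (Finset.mem_Icc.2 ⟨hp.trans hpr, hrB.trans hBM⟩) hrU
  · refine ⟨h3.1, ?_, h2, h3.2, h.insert_first hp h3.1 h3.2⟩
    by_contra hc
    exact hrU (h3.2 r hpr (by omega))
  · exact (hrU (h3.1 r hpr (hrB.trans hBM))).elim

/-- The cars that prefer spaces in `[1, B]` and those that prefer spaces in `(B, M]` do not
interact if the former fit into `[1, B]` and there is room for the latter in `(B, M]`. -/
theorem wordWeight_union {B M : ℕ} (hBM : B ≤ M) (w : List ℕ) (hw : ∀ p ∈ w, p ∈ Finset.Ioc 0 M)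
    (U₁ U₂ : Finset ℕ) (h₁ : U₁ ⊆ Finset.Ioc 0 B) (h₂ : U₂ ⊆ Finset.Ioc B M)
    (hfit : Fits B U₁ (w.filter (fun p => p ≤ B)))
    (hroom : U₂.card + (w.filter (fun p => ¬ p ≤ B)).length ≤ M - B) :
    wordWeight (stepInside M) (U₁ ∪ U₂) w =
      wordWeight (stepInside M) U₁ (w.filter (fun p => p ≤ B)) *
        wordWeight (stepInside M) U₂ (w.filter (fun p => ¬ p ≤ B)) := by
  induction w generalizing U₁ U₂ with
  | nil => simp [wordWeight]
  | cons p w ih =>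
    have hp := Finset.mem_Ioc.1 (hw p (by simp))
    have hw' : ∀ p ∈ w, p ∈ Finset.Ioc 0 M := fun q hq => hw q (by simp [hq])
    by_cases hpB : p ≤ B
    · have hf1 : (p :: w).filter (fun p => p ≤ B) = p :: w.filter (fun p => p ≤ B) := by simp [hpB]
      have hf2 : (p :: w).filter (fun p => ¬ p ≤ B) = w.filter (fun p => ¬ p ≤ B) := by simp [hpB]
      rw [hf1] at hfit ⊢
      rw [hf2] at hroom ⊢
      obtain ⟨h3, h4, h5, h6, h7⟩ := hfit.parkInside hp.1 hpB hBM
      have hpark : parkInside M (U₁ ∪ U₂) p = parkInside M U₁ p := by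
        refine parkInside_eq_of_first hp.1 h3 (h4.trans hBM) ?_ ?_
        · rw [Finset.mem_union, not_or]
          refine ⟨h5, fun hc => ?_⟩
          have := Finset.mem_Ioc.1 (h₂ hc)
          omega
        · exact fun x hx hx' => Finset.mem_union_left _ (h6 x hx hx')
      have hmem : p ∈ U₁ ∪ U₂ ↔ p ∈ U₁ := by
        rw [Finset.mem_union, or_iff_left]
        intro hc
        have := Finset.mem_Ioc.1 (h₂ hc)
        omega
      have hstep : stepInside M (U₁ ∪ U₂) p = stepInside M U₁ p ∪ U₂ := by
        rw [stepInside, stepInside, hpark, Finset.insert_union]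
      simp only [wordWeight, hmem]
      rw [hstep, ih hw' (stepInside M U₁ p) U₂
        (Finset.insert_subset (Finset.mem_Ioc.2 ⟨by omega, h4⟩) h₁) h₂ h7 hroom, mul_assoc]
    · have hf1 : (p :: w).filter (fun p => p ≤ B) = w.filter (fun p => p ≤ B) := by simp [hpB]
      have hf2 : (p :: w).filter (fun p => ¬ p ≤ B) = p :: w.filter (fun p => ¬ p ≤ B) :=
        List.filter_cons_of_pos (by simpa using hpB)
      rw [hf1] at hfit ⊢
      rw [hf2] at hroom ⊢
      rw [List.length_cons] at hroom
      have hlt : U₂.card < M - B := by omega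
      obtain ⟨h3, h4⟩ := parkInside_mem_Ioc hlt (show B < p by omega)
      obtain ⟨r, hr, hrU⟩ := _root_.exists_free hlt
      have h3' := Finset.mem_Ioc.1 h3
      have hr' := Finset.mem_Ioc.1 hr
      have hpark : parkInside M (U₁ ∪ U₂) p = parkInside M U₂ p := by
        have hnot : parkInside M U₂ p ∉ U₁ ∪ U₂ := by
          rw [Finset.mem_union, not_or]
          refine ⟨fun hc => ?_, h4⟩
          have := Finset.mem_Ioc.1 (h₁ hc)
          omega
        -- In both cases the spaces that must be taken for this choice already lie in `U₂`, so
        -- adding `U₁` does not alter it.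
        obtain ⟨h5, h6, h7 | h7⟩ := parkInside_spec (M := M) (p := p) hp.1
          (Finset.mem_Icc.2 ⟨by omega, hr'.2⟩) hrU
        · exact parkInside_eq_of_first hp.1 h7.1 h3'.2 hnot
            fun x hx hx' => Finset.mem_union_right _ (h7.2 x hx hx')
        · exact parkInside_eq_of_last hp.1 (by omega) h3'.2 hnot
            (fun x hx hx' => Finset.mem_union_right _ (h7.1 x hx hx'))
            (fun x hx hx' => Finset.mem_union_right _ (h7.2 x hx hx'))
      have hmem : p ∈ U₁ ∪ U₂ ↔ p ∈ U₂ := by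
        rw [Finset.mem_union, or_iff_right]
        intro hc
        have := Finset.mem_Ioc.1 (h₁ hc)
        omega
      have hstep : stepInside M (U₁ ∪ U₂) p = U₁ ∪ stepInside M U₂ p := by
        rw [stepInside, stepInside, hpark, Finset.union_insert]
      have hcard : (stepInside M U₂ p).card = U₂.card + 1 := Finset.card_insert_of_notMem h4
      simp only [wordWeight, hmem]
      rw [hstep, ih hw' U₁ (stepInside M U₂ p) h₁ (Finset.insert_subset h3 h₂) hfit (by omega)]
      ring

/-! ### Parking words -/

/-- `w` has `k` letters, at least `i` of which are at most `Y i`, for `i = 1, …, k`. -/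
def IsParkingWord (Y : ℕ → ℕ) (k : ℕ) (w : List ℕ) : Prop :=
  w.length = k ∧ ∀ i < k, i + 1 ≤ w.countP (fun p => p ≤ Y (i + 1))

theorem StrictMono.add_sub_le {Y : ℕ → ℕ} (hY : StrictMono Y) {i j : ℕ} (h : i ≤ j) :
    Y i + (j - i) ≤ Y j := by
  induction j, h using Nat.le_induction with
  | base => simp
  | succ j h ih =>
    have := hY (Nat.lt_add_one j)
    omega

theorem countP_lt_add_countP_le (c : ℕ) (w : List ℕ) :
    w.countP (fun p => c < p) + w.countP (fun p => p ≤ c) = w.length := by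
  rw [List.length_eq_countP_add_countP (fun p => decide (c < p))]
  simp [not_lt]

/-- If `Y i ≤ c < Y (i + 1)`, at most `k - i` letters exceed `c`, while strict growth leaves at
least `k - i + 1` spaces in `(c, Y (k + 1)]`. The spare one pays for the unavailable space; hence
the bound `Y (k + 1)` and not `Y k`. -/
theorem IsParkingWord.fits {Y : ℕ → ℕ} (hY : StrictMono Y) {k : ℕ} {w : List ℕ}
    (hw : IsParkingWord Y k w) {U : Finset ℕ} (hU : U.card ≤ 1) : Fits (Y (k + 1)) U w := by
  intro c hc
  have hex : ∃ i, c < Y (i + 1) := ⟨k, hc⟩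
  obtain ⟨i, hi, hmin⟩ : ∃ i, c < Y (i + 1) ∧ ∀ j < i, ¬ c < Y (j + 1) :=
    ⟨Nat.find hex, Nat.find_spec hex, fun j hj => Nat.find_min hex hj⟩
  have hik : i ≤ k := by
    by_contra hc'
    exact hmin k (by omega) hc
  have hcount : i ≤ w.countP (fun p => p ≤ c) := by
    rcases i with _ | i
    · omega
    · refine (hw.2 i (by omega)).trans (List.countP_mono_left fun p _ hp => ?_)
      have := hmin i (by omega)
      simp only [decide_eq_true_eq] at hp ⊢
      omega
  have h1 := countP_lt_add_countP_le c w
  rw [hw.1] at h1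
  have h2 := hY.add_sub_le (show i + 1 ≤ k + 1 by omega)
  have h3 := Finset.card_le_card (Finset.inter_subset_right (s₁ := Finset.Ioc c (Y (k + 1)))
    (s₂ := U))
  omega

theorem isParkingWord_filter_iff {Y : ℕ → ℕ} (hY : StrictMono Y) (k : ℕ) (w : List ℕ) :
    IsParkingWord Y k (w.filter (fun p => p ≤ Y (k + 1))) ↔
      w.countP (fun p => p ≤ Y (k + 1)) = k ∧
        ∀ i < k, i + 1 ≤ w.countP (fun p => p ≤ Y (i + 1)) := by
  rw [IsParkingWord, ← List.countP_eq_length_filter]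
  refine and_congr_right fun _ => forall₂_congr fun i hi => ?_
  rw [List.countP_filter]
  have := hY (show i + 1 < k + 1 by omega)
  refine iff_of_eq (congrArg _ (List.countP_congr fun p _ => ?_))
  simp only [Bool.and_eq_true, decide_eq_true_eq]
  omega

/-- The length is the least `k` with at most `k` letters in `[1, Y (k + 1)]` (for positive letters).
Minimality gives the parking inequalities, and monotonicity of the counts forces equality. A smaller
`k'` contradicts minimality, a larger one its own inequality at `k`. -/
theorem existsUnique_isParkingWord_filter {Y : ℕ → ℕ} (hY : StrictMono Y) (w : List ℕ) :
    ∃ k ≤ w.length, IsParkingWord Y k (w.filter (fun p => p ≤ Y (k + 1))) ∧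
      ∀ k', IsParkingWord Y k' (w.filter (fun p => p ≤ Y (k' + 1))) → k' = k := by
  simp only [isParkingWord_filter_iff hY]
  have hex : ∃ k, w.countP (fun p => p ≤ Y (k + 1)) ≤ k := ⟨w.length, List.countP_le_length⟩
  obtain ⟨k, hk, hmin⟩ : ∃ k, w.countP (fun p => p ≤ Y (k + 1)) ≤ k ∧
      ∀ j < k, ¬ w.countP (fun p => p ≤ Y (j + 1)) ≤ j :=
    ⟨Nat.find hex, Nat.find_spec hex, fun j hj => Nat.find_min hex hj⟩
  have hkl : k ≤ w.length := by
    by_contra hc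
    exact hmin w.length (by omega) List.countP_le_length
  refine ⟨k, hkl, ⟨?_, fun i hi => ?_⟩, fun k' hk' => ?_⟩
  · refine hk.antisymm ?_
    rcases k with _ | k
    · omega
    · have h1 := hmin k (by omega)
      have h2 : w.countP (fun p => p ≤ Y (k + 1)) ≤ w.countP (fun p => p ≤ Y (k + 1 + 1)) :=
        List.countP_mono_left fun p _ hp => by
          have := hY (Nat.lt_add_one (k + 1))
          simp only [decide_eq_true_eq] at hp ⊢
          omega
      omega
  · have := hmin i hi
    omega
  · rcases lt_trichotomy k k' with h | h | h
    · have := hk'.2 k h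
      omega
    · exact h.symm
    · exact (hmin k' h hk'.1.le).elim

open Classical in
/-- The sum of the weights of the parking words of length `n`. -/
noncomputable def parkingSum (Y : ℕ → ℕ) (M : ℕ) (U : Finset ℕ) (n : ℕ) : ℝ[X] :=
  wordSum (Finset.Ioc 0 (Y (n + 1))) n fun w =>
    if IsParkingWord Y n w then wordWeight (stepInside M) U w else 0

theorem wordSum_eq_zero {R : Type*} [CommRing R] {A : Finset ℕ} {n : ℕ} {f : List ℕ → R}
    (h : ∀ w, w.length = n → f w = 0) : wordSum A n f = 0 := by
  rw [wordSum_congr (g := fun _ => 0 * 0) fun w hw _ => by rw [h w hw, mul_zero],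
    wordSum_mul_left, zero_mul]

/-- Decomposition of the words over `[1, Y K]` by their longest initial parking word. -/
theorem prod_range_eq_sum_parkingSum {Y : ℕ → ℕ} (hY : StrictMono Y) {K n : ℕ}
    (hn : n < K) {U : Finset ℕ} (hU : U ⊆ {1}) :
    ∏ i ∈ Finset.range n, ((Y K : ℝ[X]) * Polynomial.X + (U.card : ℝ[X]) + (i : ℝ[X])) =
      ∑ k ∈ Finset.range (n + 1), (n.choose k : ℝ[X]) * (parkingSum Y (Y K) U k *
        ∏ i ∈ Finset.range (n - k),
          (((Y K - Y (k + 1) : ℕ) : ℝ[X]) * Polynomial.X + (i : ℝ[X]))) := by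
  classical
  have hU1 : U.card ≤ 1 := by simpa using Finset.card_le_card hU
  have hK : K ≤ Y K := by simpa using hY.le_apply (x := K)
  have hroom (k : ℕ) (hk : k ≤ n) : n - k ≤ Y K - Y (k + 1) := by
    have := hY.add_sub_le (show k + 1 ≤ K by omega)
    omega
  have hsub (k : ℕ) : U ⊆ Finset.Ioc 0 (Y (k + 1)) := by
    refine hU.trans ?_
    have : k + 1 ≤ Y (k + 1) := hY.le_apply
    simp only [Finset.singleton_subset_iff, Finset.mem_Ioc]
    omega
  have htotal := wordSum_wordWeight 0 (Y K) n U
    ((hsub 0).trans (Finset.Ioc_subset_Ioc_right (hY.monotone (by omega)))) (by omega)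
  rw [Nat.sub_zero] at htotal
  rw [← htotal]
  -- Any unavailable space lies in the lower block, so the upper block starts from `∅`. Exactly one
  -- summand is nonzero.
  have hsplit : ∀ w : List ℕ, w.length = n → (∀ p ∈ w, p ∈ Finset.Ioc 0 (Y K)) →
      wordWeight (stepInside (Y K)) U w = ∑ k ∈ Finset.range (n + 1),
        (fun u => if IsParkingWord Y k u then wordWeight (stepInside (Y K)) U u else 0)
            (w.filter (fun p => p ≤ Y (k + 1))) *
          wordWeight (stepInside (Y K)) ∅ (w.filter (fun p => ¬ p ≤ Y (k + 1))) := by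
    intro w hwn hw
    obtain ⟨k, hk, hkw, huniq⟩ := existsUnique_isParkingWord_filter hY w
    rw [hwn] at hk
    rw [Finset.sum_eq_single k]
    · dsimp only
      rw [if_pos hkw, ← wordWeight_union (hY.monotone (by omega)) w hw U ∅ (hsub k) (by simp)
        (hkw.fits hY hU1), Finset.union_empty]
      have h1 := hkw.1
      have h2 := countP_lt_add_countP_le (Y (k + 1)) w
      have h3 := hroom k hk
      rw [List.countP_eq_length_filter, List.countP_eq_length_filter, h1] at h2
      simp only [not_le, Finset.card_empty]
      omega
    · intro k' _ hne
      dsimp only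
      rw [if_neg fun h => hne (huniq k' h), zero_mul]
    · intro h
      exact (h (Finset.mem_range.2 (by omega))).elim
  rw [wordSum_congr hsplit, wordSum_sum]
  refine Finset.sum_congr rfl fun k hk => ?_
  have hk := Finset.mem_range.1 hk
  refine (wordSum_shuffle (fun p => p ≤ Y (k + 1)) n
    (fun u => if IsParkingWord Y k u then wordWeight (stepInside (Y K)) U u else 0)
    (wordWeight (stepInside (Y K)) ∅)).trans ?_
  -- Parking words for `k` have length `k`, so one shuffle type survives.
  rw [Finset.sum_eq_single (k, n - k)]
  · have hle : Y (k + 1) ≤ Y K := hY.monotone (by omega)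
    have hA1 : (Finset.Ioc 0 (Y K)).filter (fun p => p ≤ Y (k + 1)) =
        Finset.Ioc 0 (Y (k + 1)) := by
      ext p
      simp only [Finset.mem_filter, Finset.mem_Ioc]
      omega
    have hA2 : (Finset.Ioc 0 (Y K)).filter (fun p => ¬ p ≤ Y (k + 1)) =
        Finset.Ioc (Y (k + 1)) (Y K) := by
      ext p
      simp only [Finset.mem_filter, Finset.mem_Ioc]
      omega
    rw [hA1, hA2, wordSum_wordWeight _ _ _ ∅ (by simp)
      (by simpa using hroom k (by omega)), parkingSum]
    simp
  · rintro ⟨p, q⟩ hpq hne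
    have hpq := Finset.HasAntidiagonal.mem_antidiagonal.1 hpq
    rw [wordSum_eq_zero (f := fun u => if IsParkingWord Y k u then _ else 0), zero_mul, mul_zero]
    intro w hw
    rw [if_neg]
    intro h
    have := h.1
    simp only [ne_eq, Prod.mk.injEq, not_and] at hne hpq hw
    exact hne (by omega) (by omega)
  · intro h
    exact (h (Finset.HasAntidiagonal.mem_antidiagonal.2 (by simp; omega))).elim

/-- After division by factorials both sides solve one unitriangular system, whose left-hand side is
the multiset coefficient of `Y K * X + U.card`. The number `K` of blocks stays fixed while the
equations for all lengths below it are used. -/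
theorem factorial_mul_dominatingSum {Y : ℕ → ℕ} (hY : StrictMono Y) {K n : ℕ} (hn : n < K)
    {U : Finset ℕ} (hU : U ⊆ {1}) {a : ℕ → ℝ[X]}
    (ha : ∀ k, ∑ i ∈ Finset.range (k + 1), a i =
      (Y (k + 1) : ℝ[X]) * Polynomial.X + (U.card : ℝ[X])) :
    (n.factorial : ℝ[X]) * dominatingSum a n n = parkingSum Y (Y K) U n := by
  have hinv (k : ℕ) : (k.factorial : ℝ[X]) * Polynomial.C ((k.factorial : ℝ)⁻¹) = 1 := by
    rw [← Polynomial.C_eq_natCast, ← Polynomial.C_mul,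
      mul_inv_cancel₀ (by exact_mod_cast k.factorial_ne_zero), Polynomial.C_1]
  suffices h : dominatingSum a n n =
      Polynomial.C ((n.factorial : ℝ)⁻¹) * parkingSum Y (Y K) U n by
    rw [h, ← mul_assoc, hinv, one_mul]
  obtain ⟨N, rfl⟩ : ∃ N, K = N + 1 := ⟨K - 1, by omega⟩
  refine eq_of_triangular (N := N)
    (A := fun k => dominatingSum a k k)
    (B := fun k => Polynomial.C ((k.factorial : ℝ)⁻¹) * parkingSum Y (Y (N + 1)) U k)
    (fun k m => multisetBinomial (((Y (N + 1) - Y (k + 1) : ℕ) : ℝ[X]) * Polynomial.X) (m - k))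
    (fun k => by rw [Nat.sub_self, multisetBinomial_zero_right]) (fun m hm => ?_)
    (by omega)
  trans multisetBinomial ((Y (N + 1) : ℝ[X]) * Polynomial.X + (U.card : ℝ[X])) m
  · rw [← ha, multisetBinomial_sum_range_of_lt a (show m < N + 1 by omega)]
    refine Finset.sum_congr rfl fun k hk => ?_
    have hk := Finset.mem_range.1 hk
    have h1 := Finset.sum_range_add_sum_Ico a (show k + 1 ≤ N + 1 by omega)
    rw [ha, ha, ← eq_sub_iff_add_eq'] at h1
    rw [h1, Nat.cast_sub (hY.monotone (by omega))]
    congr 2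
    ring
  · apply mul_left_cancel₀ (factorial_ne_zero_polynomial m)
    rw [factorial_mul_multisetBinomial, prod_range_eq_sum_parkingSum hY (by omega) hU,
      Finset.mul_sum]
    refine Finset.sum_congr rfl fun k hk => ?_
    have hk := Finset.mem_range.1 hk
    rw [← factorial_mul_multisetBinomial,
      ← Nat.choose_mul_factorial_mul_factorial (show k ≤ m by omega)]
    push_cast
    linear_combination (-(m.choose k : ℝ[X]) * ((m - k).factorial : ℝ[X]) *
      parkingSum Y (Y (N + 1)) U k * multisetBinomial
      (((Y (N + 1) - Y (k + 1) : ℕ) : ℝ[X]) * Polynomial.X) (m - k)) * hinv k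

/-! ### The linear protocol -/

theorem parkCar_eq_some {m p s : ℕ} {V : Finset ℕ} (hps : p ≤ s) (hsm : s ≤ m) (hs : s ∉ V)
    (h : ∀ x, p ≤ x → x < s → x ∈ V) : parkCar m V p = some s := by
  have hmem : s ∈ Finset.Icc p m \ V := by simp [hps, hsm, hs]
  have hne : (Finset.Icc p m \ V).Nonempty := ⟨s, hmem⟩
  rw [parkCar, dif_pos hne]
  congr 1
  refine (Finset.min'_le _ _ hmem).antisymm (Finset.le_min' _ _ _ fun x hx => ?_)
  simp only [Finset.mem_sdiff, Finset.mem_Icc] at hx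
  by_contra hc
  exact hx.2 (h x hx.1.1 (by omega))

theorem parkCar_eq_none {m p : ℕ} {V : Finset ℕ} (h : ∀ x, p ≤ x → x ≤ m → x ∈ V) :
    parkCar m V p = none := by
  rw [parkCar, dif_neg]
  rintro ⟨x, hx⟩
  simp only [Finset.mem_sdiff, Finset.mem_Icc] at hx
  exact hx.2 (h x hx.1.1 hx.1.2)

/-- The product over the cars of a word of `X` for the lucky and `1 + X` for the unlucky cars, in
the linear protocol. -/
noncomputable def linearWeight (m : ℕ) : Finset ℕ → List ℕ → ℝ[X]
  | _, [] => 1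
  | V, p :: w => (if parkCar m V p = some p then Polynomial.X else 1 + Polynomial.X) *
      linearWeight m (V ∪ (parkCar m V p).toFinset) w

/-- The two protocols agree on the spaces up to `m`. A car that fails in the short street parks
beyond `m` in the long one; it is unlucky in both and never disturbs a later car. -/
theorem linearWeight_eq_wordWeight {m B M : ℕ} (hmB : m ≤ B) (hBM : B ≤ M) (w : List ℕ)
    (hw : ∀ p ∈ w, 1 ≤ p ∧ p ≤ m) (U V : Finset ℕ) (hUV : ∀ x ≤ m, x ∈ V ↔ x ∈ U)
    (hfit : Fits B U w) : linearWeight m V w = wordWeight (stepInside M) U w := by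
  induction w generalizing U V with
  | nil => rfl
  | cons p w ih =>
    obtain ⟨hp1, hpm⟩ := hw p (by simp)
    obtain ⟨h1, h2, h3, h4, h5⟩ := hfit.parkInside hp1 (hpm.trans hmB) hBM
    have hlucky : parkCar m V p = some p ↔ p ∉ U := by
      constructor
      · intro h hc
        rw [parkCar] at h
        split_ifs at h with hne
        have := Finset.min'_mem _ hne
        rw [Option.some.inj h, Finset.mem_sdiff] at this
        exact this.2 ((hUV p hpm).2 hc)
      · exact fun h => parkCar_eq_some le_rfl hpm (fun hc => h ((hUV p hpm).1 hc))
          fun x hx hx' => by omega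
    have hstep : ∀ x ≤ m, x ∈ V ∪ (parkCar m V p).toFinset ↔ x ∈ stepInside M U p := by
      intro x hx
      rw [stepInside, Finset.mem_union, Finset.mem_insert, hUV x hx, Option.mem_toFinset]
      rcases le_or_gt (parkInside M U p) m with hle | hlt
      · rw [parkCar_eq_some h1 hle (fun hc => h3 ((hUV _ hle).1 hc))
          fun x hx hx' => (hUV x (by omega)).2 (h4 x hx hx'), Option.mem_some, or_comm, eq_comm]
      · rw [parkCar_eq_none fun x hx hx' => (hUV x hx').2 (h4 x hx (by omega))]
        simp only [Option.not_mem_none, or_false]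
        constructor
        · exact Or.inr
        · rintro (rfl | h)
          · omega
          · exact h
    simp only [linearWeight, wordWeight, hlucky]
    rw [ih (fun q hq => hw q (by simp [hq])) _ _ hstep h5, ite_not]

/-- Links the recursion on lists with the car-indexed `blocked`, by downward induction on the number
of cars already arrived. -/
theorem linearWeight_drop (m : ℕ) (l : Fin 2) {n : ℕ} (w : Fin n → ℕ) (φ : ℕ → ℝ[X])
    (hφ : ∀ j : Fin n, φ j =
      if parkingOut m l w j = some (w j) then Polynomial.X else 1 + Polynomial.X)
    {j : ℕ} (hj : j ≤ n) :
    linearWeight m (blocked m l w j) ((List.ofFn w).drop j) = ∏ i ∈ Finset.Ico j n, φ i := by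
  induction hj using Nat.decreasingInduction with
  | self => rw [List.drop_of_length_le (by simp), linearWeight, Finset.Ico_self, Finset.prod_empty]
  | of_succ j hj ih =>
    have hj' : j < (List.ofFn w).length := by simpa using hj
    rw [List.drop_eq_getElem_cons hj', Finset.prod_eq_prod_Ico_succ_bot (by omega), ← ih,
      List.getElem_ofFn]
    simp only [linearWeight]
    congr 1
    · exact (hφ ⟨j, by omega⟩).symm
    · rw [blocked, dif_pos (by omega)]

theorem linearWeight_ofFn (m : ℕ) (l : Fin 2) {n : ℕ} (w : Fin n → ℕ) :
    linearWeight m (if l = 1 then {1} else ∅) (List.ofFn w) =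
      Polynomial.X ^ (luckySet m l w).card *
        (1 + Polynomial.X) ^ (n - (luckySet m l w).card) := by
  have h := linearWeight_drop m l w (fun j => if h : j < n then
    if parkingOut m l w ⟨j, h⟩ = some (w ⟨j, h⟩) then Polynomial.X else 1 + Polynomial.X else 1)
    (fun j => by simp) (Nat.zero_le n)
  rw [List.drop_zero, ← Finset.range_eq_Ico, ← Fin.prod_univ_eq_prod_range] at h
  rw [blocked] at h
  rw [h]
  simp only [Fin.is_lt, dite_true, Fin.eta]
  rw [Finset.prod_ite, Finset.prod_const, Finset.prod_const, ← luckySet, Finset.filter_not,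
    ← luckySet, Finset.card_sdiff_of_subset (Finset.subset_univ _), Finset.card_univ,
    Fintype.card_fin]

/-! ### Lattice points below a staircase -/

/-- The number of `x : Fin k → ℕ` whose partial sums are at most `Z 1, …, Z k`, and whose total is
at most `c`. -/
def staircaseCount (Z : ℕ → ℕ) : ℕ → ℕ → ℕ
  | 0, _ => 1
  | k + 1, c => ∑ b ∈ Finset.range (min c (Z (k + 1)) + 1), staircaseCount Z k b

/-- The points counted by `staircaseCount`. -/
def staircasePoints (Z : ℕ → ℕ) (k c : ℕ) : Finset (Fin k → ℕ) :=
  (Fintype.piFinset fun _ => Finset.range (c + 1)).filter fun x =>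
    (∀ i : Fin k, ∑ j ∈ Finset.Iic i, x j ≤ Z ((i : ℕ) + 1)) ∧ ∑ j, x j ≤ c

theorem mem_staircasePoints {Z : ℕ → ℕ} {k c : ℕ} {x : Fin k → ℕ} :
    x ∈ staircasePoints Z k c ↔
      (∀ i : Fin k, ∑ j ∈ Finset.Iic i, x j ≤ Z ((i : ℕ) + 1)) ∧ ∑ j, x j ≤ c := by
  rw [staircasePoints, Finset.mem_filter, and_iff_right_iff_imp]
  intro h
  refine Fintype.mem_piFinset.2 fun i => Finset.mem_range.2 ?_
  have := Finset.single_le_sum (fun j _ => Nat.zero_le (x j)) (Finset.mem_univ i)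
  have := h.2
  omega

/-- The summation index `b` of the recursion is the total of all coordinates; the last coordinate is
`b` minus the others. -/
theorem card_staircasePoints (Z : ℕ → ℕ) (k c : ℕ) :
    (staircasePoints Z k c).card = staircaseCount Z k c := by
  induction k generalizing c with
  | zero =>
    rw [staircaseCount, Finset.card_eq_one]
    refine ⟨Fin.elim0, Finset.eq_singleton_iff_unique_mem.2 ⟨?_, fun x _ => Subsingleton.elim _ _⟩⟩
    rw [mem_staircasePoints]
    exact ⟨fun i => i.elim0, by simp⟩
  | succ k ih =>
    simp only [staircaseCount, ← ih]
    rw [← Finset.card_sigma]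
    refine Finset.card_bij' (fun x _ => ⟨∑ j, x j, fun i => x i.castSucc⟩)
      (fun x _ => Fin.snoc x.2 (x.1 - ∑ j, x.2 j)) ?_ ?_ ?_ ?_
    · intro x hx
      rw [mem_staircasePoints, Fin.forall_fin_succ', Fin.sum_Iic_last] at hx
      simp only [Fin.sum_Iic_castSucc, Fin.val_castSucc, Fin.val_last] at hx
      rw [Finset.mem_sigma, Finset.mem_range, mem_staircasePoints]
      refine ⟨Nat.lt_succ_of_le (le_min hx.2 hx.1.2), hx.1.1, ?_⟩
      dsimp only
      rw [Fin.sum_univ_castSucc x]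
      omega
    · rintro ⟨b, x⟩ hx
      rw [Finset.mem_sigma, Finset.mem_range, mem_staircasePoints] at hx
      dsimp only at hx
      rw [mem_staircasePoints, Fin.forall_fin_succ', Fin.sum_Iic_last]
      simp only [Fin.sum_Iic_castSucc, Fin.val_castSucc, Fin.val_last, Fin.snoc_castSucc,
        Fin.sum_univ_castSucc, Fin.snoc_last]
      have := hx.2.2
      exact ⟨⟨hx.2.1, by omega⟩, by omega⟩
    · intro x hx
      refine funext fun i => Fin.lastCases ?_ (fun i => ?_) i
      · simp [Fin.sum_univ_castSucc x]
      · simp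
    · rintro ⟨b, x⟩ hx
      rw [Finset.mem_sigma, Finset.mem_range, mem_staircasePoints] at hx
      have := hx.2.2
      dsimp only at this
      simp only [Fin.snoc_castSucc, Fin.sum_univ_castSucc, Fin.snoc_last, Sigma.mk.injEq, heq_eq_eq,
        and_true]
      omega

theorem staircaseCount_zero_right (Z : ℕ → ℕ) (k : ℕ) : staircaseCount Z k 0 = 1 := by
  induction k with
  | zero => rfl
  | succ k ih => simp [staircaseCount, ih]

theorem staircaseCount_of_le {Z : ℕ → ℕ} {k c : ℕ} (h : Z k ≤ c) :
    staircaseCount Z k c = staircaseCount Z k (Z k) := by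
  cases k with
  | zero => rfl
  | succ k => simp [staircaseCount, h]

theorem staircaseCount_succ_succ (Z : ℕ → ℕ) (k c : ℕ) :
    staircaseCount Z (k + 1) (c + 1) = staircaseCount Z (k + 1) c +
      if c + 1 ≤ Z (k + 1) then staircaseCount Z k (c + 1) else 0 := by
  simp only [staircaseCount]
  split_ifs with h
  · rw [min_eq_left h, min_eq_left (by omega), Finset.sum_range_succ]
  · rw [min_eq_right (by omega), min_eq_right (by omega), add_zero]

/-- Decomposition of the weakly increasing sequences by the first step that leaves the
staircase. -/
theorem multichoose_eq_staircaseCount_add {Z : ℕ → ℕ} (hZ : Monotone Z) (k c : ℕ) :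
    Nat.multichoose (c + 1) k = staircaseCount Z k c + ∑ i ∈ Finset.range k,
      staircaseCount Z i (Z i) * Nat.multichoose (c - Z (i + 1)) (k - i) := by
  induction k generalizing c with
  | zero => simp [staircaseCount]
  | succ k ih =>
    induction c with
    | zero =>
      rw [staircaseCount_zero_right, Finset.sum_eq_zero]
      · simp
      · intro i hi
        have := Finset.mem_range.1 hi
        rw [Nat.zero_sub, show k + 1 - i = k - i + 1 by omega, Nat.multichoose_zero_succ, mul_zero]
    | succ c ihc =>
      rw [Nat.multichoose_succ_succ, ihc, ih (c + 1), staircaseCount_succ_succ]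
      have hstep : ∀ i ∈ Finset.range k,
          staircaseCount Z i (Z i) * Nat.multichoose (c + 1 - Z (i + 1)) (k + 1 - i) =
          staircaseCount Z i (Z i) * Nat.multichoose (c - Z (i + 1)) (k + 1 - i) +
          staircaseCount Z i (Z i) * Nat.multichoose (c + 1 - Z (i + 1)) (k - i) := by
        intro i hi
        -- Since `i < k`, the lower indices are positive, so truncated subtraction to `0` makes all
        -- terms vanish.
        obtain ⟨d, rfl⟩ := Nat.exists_eq_add_of_lt (Finset.mem_range.1 hi)
        rw [show i + d + 1 + 1 - i = d + 1 + 1 by omega, show i + d + 1 - i = d + 1 by omega]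
        rcases le_or_gt (Z (i + 1)) c with h | h
        · rw [Nat.succ_sub h, Nat.succ_eq_add_one, Nat.multichoose_succ_succ, mul_add]
        · rw [show c + 1 - Z (i + 1) = 0 by omega, show c - Z (i + 1) = 0 by omega]
          simp
      rw [Finset.sum_range_succ, Finset.sum_range_succ, Finset.sum_congr rfl hstep,
        Finset.sum_add_distrib, show k + 1 - k = 1 by omega, Nat.multichoose_one_right,
        Nat.multichoose_one_right]
      -- The index `i = k` remains: for `c + 1 ≤ Z (k + 1)` its term is zero; otherwise it grows by
      -- `staircaseCount Z k (Z k)`, the stable value of `staircaseCount Z k (c + 1)`.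
      split_ifs with h
      · rw [show c + 1 - Z (k + 1) = 0 by omega, show c - Z (k + 1) = 0 by omega]
        ring
      · rw [staircaseCount_of_le (show Z k ≤ c + 1 from
          (hZ (Nat.le_succ k)).trans (by rw [Nat.succ_eq_add_one]; omega)),
          show c + 1 - Z (k + 1) = c - Z (k + 1) + 1 by omega]
        ring

theorem eval_multisetBinomial {p : ℝ[X]} {x : ℝ} {m : ℕ} (h : p.eval x = m) (k : ℕ) :
    (multisetBinomial p k).eval x = (Nat.multichoose m k : ℝ) := by
  have h1 := congrArg (Polynomial.eval x) (factorial_mul_multisetBinomial p k)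
  rw [Polynomial.eval_mul, Polynomial.eval_natCast, Polynomial.eval_prod] at h1
  simp only [Polynomial.eval_add, h, Polynomial.eval_natCast] at h1
  have h2 := Nat.ascFactorial_eq_factorial_mul_choose' m k
  rw [← Nat.multichoose_eq, Nat.ascFactorial_eq_prod_range] at h2
  apply mul_left_cancel₀ (show (k.factorial : ℝ) ≠ 0 by exact_mod_cast k.factorial_ne_zero)
  rw [h1]
  exact_mod_cast h2

/-- The value of the sum over dominating compositions as a number of lattice points. -/
theorem eval_dominatingSum {Y : ℕ → ℕ} (hY : Monotone Y) {a : ℕ → ℝ[X]}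
    (ha : ∀ k, ∑ i ∈ Finset.range (k + 1), a i = (Y (k + 1) : ℝ[X]) * Polynomial.X + 1)
    (n t : ℕ) :
    (dominatingSum a n n).eval (t : ℝ) =
      (staircaseCount (fun k => t * Y k) n (t * Y n) : ℝ) := by
  have hZ : Monotone fun k => t * Y k := fun i j h => Nat.mul_le_mul_left t (hY h)
  refine eq_of_triangular (N := n)
    (A := fun k => (dominatingSum a k k).eval (t : ℝ))
    (B := fun k => (staircaseCount (fun k => t * Y k) k (t * Y k) : ℝ))
    (fun k m => (Nat.multichoose (t * Y (n + 1) - t * Y (k + 1)) (m - k) : ℝ))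
    (fun k => by rw [Nat.sub_self, Nat.multichoose_zero_right, Nat.cast_one])
    (fun m hm => ?_) le_rfl
  -- The `+ 1` is the Kronecker delta of `l = 1`; combinatorially it counts the value `0` among `0,
  -- …, t * Y (n + 1)`.
  trans (Nat.multichoose (t * Y (n + 1) + 1) m : ℝ)
  · rw [← eval_multisetBinomial (p := ∑ i ∈ Finset.range (n + 1), a i) (x := t)
      (by rw [ha]; simp [mul_comm]),
      multisetBinomial_sum_range_of_lt a (show m < n + 1 by omega), Polynomial.eval_finsetSum]
    refine Finset.sum_congr rfl fun k hk => ?_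
    have hk := Finset.mem_range.1 hk
    have h1 := Finset.sum_range_add_sum_Ico a (show k + 1 ≤ n + 1 by omega)
    rw [ha, ha, ← eq_sub_iff_add_eq'] at h1
    rw [Polynomial.eval_mul, eval_multisetBinomial (m := t * Y (n + 1) - t * Y (k + 1))]
    rw [h1, Nat.cast_sub (hZ (show k + 1 ≤ n + 1 by omega))]
    simp [mul_comm]
  -- The leading term stabilises and supplies the summand with index `m`.
  · rw [multichoose_eq_staircaseCount_add hZ, staircaseCount_of_le (Z := fun k => t * Y k)
        (hZ (show m ≤ n + 1 by omega)),
      Finset.sum_range_succ, Nat.sub_self, Nat.multichoose_zero_right]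
    push_cast
    ring

theorem mem_latticePoints_pitmanStanley {n : ℕ} (y : Fin n → ℕ) {t : ℕ} (ht : 0 < t)
    (z : Fin n → ℤ) : z ∈ latticePoints (pitmanStanley y) t ↔
      (∀ i, 0 ≤ z i) ∧ ∀ k, ∑ i ∈ Finset.Iic k, z i ≤ (t : ℤ) * ∑ i ∈ Finset.Iic k, (y i : ℤ) := by
  have ht' : (0 : ℝ) < t := by exact_mod_cast ht
  rw [latticePoints, Set.mem_ofPred_eq, Set.mem_smul_set_iff_inv_smul_mem₀ ht'.ne', pitmanStanley]
  simp only [Set.mem_ofPred_eq, Pi.smul_apply, smul_eq_mul, ← Finset.mul_sum]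
  refine and_congr (forall_congr' fun i => ?_) (forall_congr' fun k => ?_)
  · rw [mul_nonneg_iff_of_pos_left (inv_pos.2 ht'), Int.cast_nonneg_iff]
  · rw [inv_mul_le_iff₀ ht']
    exact_mod_cast Iff.rfl

/-- The lattice points of the dilated Pitman--Stanley polytope. -/
theorem ncard_latticePoints_pitmanStanley {n : ℕ} (y : Fin n → ℕ) {Y : ℕ → ℕ}
    (hYy : ∀ i : Fin n, ∑ j ∈ Finset.Iic i, y j = Y ((i : ℕ) + 1)) {t : ℕ} (ht : 0 < t) :
    (latticePoints (pitmanStanley y) t).Finite ∧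
      (latticePoints (pitmanStanley y) t).ncard =
        staircaseCount (fun k => t * Y k) n (t * Y n) := by
  have himage : latticePoints (pitmanStanley y) t = (fun (x : Fin n → ℕ) i => (x i : ℤ)) ''
      (staircasePoints (fun k => t * Y k) n (t * Y n) : Set (Fin n → ℕ)) := by
    ext z
    rw [mem_latticePoints_pitmanStanley y ht]
    simp only [Set.mem_image, Finset.mem_coe, mem_staircasePoints]
    constructor
    · rintro ⟨h0, h1⟩
      lift z to Fin n → ℕ using h0
      have h2 : ∀ i : Fin n, ∑ j ∈ Finset.Iic i, z j ≤ t * Y ((i : ℕ) + 1) := by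
        intro i
        have := h1 i
        beta_reduce at this
        rw [← hYy]
        exact_mod_cast this
      refine ⟨z, ⟨h2, ?_⟩, rfl⟩
      cases n with
      | zero => simp
      | succ n =>
        have := h2 (Fin.last n)
        rwa [Fin.sum_Iic_last] at this
    · rintro ⟨x, ⟨h1, -⟩, rfl⟩
      refine ⟨fun i => Int.natCast_nonneg _, fun k => ?_⟩
      have := h1 k
      rw [← hYy] at this
      beta_reduce
      exact_mod_cast this
  have hinj : Function.Injective fun (x : Fin n → ℕ) i => (x i : ℤ) :=
    fun x x' h => funext fun i => Int.natCast_inj.1 (congrFun h i)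
  rw [himage, Set.ncard_image_of_injective _ hinj, Set.ncard_coe_finset, card_staircasePoints]
  exact ⟨(Finset.finite_toSet _).image _, rfl⟩

/-! ### The magic basis -/

theorem coeff_X_pow_mul_one_add_X_pow (a b k : ℕ) :
    (Polynomial.X ^ a * (1 + Polynomial.X) ^ b : ℝ[X]).coeff k =
      if a ≤ k then (b.choose (k - a) : ℝ) else 0 := by
  rw [Polynomial.coeff_X_pow_mul', Polynomial.coeff_one_add_X_pow]

/-- The lowest term of `X ^ i * (1 + X) ^ (d - i)` is `X ^ i`, so comparing coefficients is a
unitriangular system. -/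
theorem IsMagicExpansion.eq {d : ℕ} {p : ℝ[X]} {c c' : Fin (d + 1) → ℝ}
    (h : IsMagicExpansion p c) (h' : IsMagicExpansion p c') : c = c' := by
  have hcoeff (c : Fin (d + 1) → ℝ) (h : IsMagicExpansion p c) (k : ℕ) : p.coeff k =
      ∑ i : Fin (d + 1), c i * if (i : ℕ) ≤ k then ((d - i).choose (k - i) : ℝ) else 0 := by
    conv_lhs => rw [h, Polynomial.finsetSum_coeff]
    simp only [mul_assoc, Polynomial.coeff_C_mul, coeff_X_pow_mul_one_add_X_pow]
  have key (k : ℕ) (hk : k < d + 1) : c ⟨k, hk⟩ = c' ⟨k, hk⟩ := by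
    induction k using Nat.strong_induction_on with
    | _ k ih =>
      have h1 := (hcoeff c h k).symm.trans (hcoeff c' h' k)
      rw [← sub_eq_zero, ← Finset.sum_sub_distrib, Finset.sum_eq_single ⟨k, hk⟩] at h1
      · simpa [sub_eq_zero] using h1
      · intro i _ hne
        split_ifs with hik
        · rw [ih i (lt_of_le_of_ne hik fun hc => hne (Fin.ext hc)) i.2, sub_self]
        · simp
      · simp
  exact funext fun i => key i i.2

/-- All basis elements are monic of degree `d`, so the coefficient of `X ^ d` is `∑ i, c i`. -/
theorem IsMagicExpansion.natDegree {d : ℕ} {p : ℝ[X]} {c : Fin (d + 1) → ℝ}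
    (h : IsMagicExpansion p c) (hc : ∑ i, c i ≠ 0) : p.natDegree = d := by
  refine Polynomial.natDegree_eq_of_le_of_coeff_ne_zero ?_ ?_
  · rw [h]
    refine Polynomial.natDegree_sum_le_of_forall_le _ _ fun i _ => ?_
    have : (1 + Polynomial.X : ℝ[X]).natDegree ≤ 1 := by
      rw [add_comm, ← Polynomial.C_1, Polynomial.natDegree_X_add_C]
    refine Polynomial.natDegree_mul_le.trans ?_
    have h1 := Polynomial.natDegree_C_mul_X_pow_le (c i) (i : ℕ)
    have h2 := Polynomial.natDegree_pow_le_of_le (d - (i : ℕ)) this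
    have := i.2
    omega
  · rw [h, Polynomial.finsetSum_coeff]
    simp only [mul_assoc, Polynomial.coeff_C_mul, coeff_X_pow_mul_one_add_X_pow]
    convert hc using 2 with i
    rw [if_pos (by omega), Nat.choose_self, Nat.cast_one, mul_one]

/-! ### The main theorem -/

/-- The partial sums of `y`, continued by `1, 1, …`. -/
def partialSum {n : ℕ} (y : Fin n → ℕ) (k : ℕ) : ℕ :=
  ∑ i ∈ Finset.range k, if h : i < n then y ⟨i, h⟩ else 1

section

variable {n : ℕ} {y : Fin n → ℕ}

theorem strictMono_partialSum (hy : ∀ i, 0 < y i) : StrictMono (partialSum y) := by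
  refine strictMono_nat_of_lt_succ fun k => ?_
  rw [partialSum, partialSum, Finset.sum_range_succ]
  split_ifs with h
  · exact Nat.lt_add_of_pos_right (hy _)
  · omega

theorem sum_Iic_eq_partialSum (y : Fin n → ℕ) (i : Fin n) :
    ∑ j ∈ Finset.Iic i, y j = partialSum y ((i : ℕ) + 1) := by
  rw [partialSum, ← Fin.sum_Iic_eq_sum_range (fun j => if h : j < n then y ⟨j, h⟩ else 1) i]
  simp

theorem sum_eq_partialSum (y : Fin n → ℕ) : ∑ j, y j = partialSum y n := by
  rw [partialSum, ← Fin.sum_univ_eq_sum_range (fun j => if h : j < n then y ⟨j, h⟩ else 1)]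
  simp

/-- The sorted entry at position `i` is at most `Y` exactly when at least `i + 1` letters are. -/
theorem mem_parkingFunctions_iff (w : Fin n → ℕ) : w ∈ parkingFunctions y ↔
    (∀ j, 1 ≤ w j) ∧ IsParkingWord (partialSum y) n (List.ofFn w) := by
  rw [parkingFunctions, Set.mem_ofPred_eq, IsParkingWord, List.length_ofFn, eq_self, true_and]
  refine and_congr_right fun _ => Fin.forall_iff.trans (forall₂_congr fun i hi => ?_)
  rw [← Tuple.lt_card_le_iff_apply_le_of_monotone (Tuple.monotone_sort w), sum_Iic_eq_partialSum,
    Nat.lt_iff_add_one_le]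
  refine iff_of_eq (congrArg _ ?_)
  trans (Finset.univ.filter fun j => w j ≤ partialSum y (i + 1)).card
  · refine Finset.card_bij (fun j _ => Tuple.sort w j) ?_
      (fun a _ b _ h => (Tuple.sort w).injective h)
      fun j hj => ⟨(Tuple.sort w).symm j, ?_, Equiv.apply_symm_apply _ _⟩
    · intro j hj
      simpa using hj
    · simpa using hj
  · rw [List.ofFn_eq_map, List.countP_map, Finset.card_def, Finset.filter_val,
      ← Multiset.countP_eq_card_filter]
    exact Multiset.coe_countP _ _

theorem IsParkingWord.le {Y : ℕ → ℕ} {k : ℕ} {w : List ℕ} (h : IsParkingWord Y k w) {p : ℕ}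
    (hp : p ∈ w) : p ≤ Y k := by
  have hk : 0 < k := by
    rw [← h.1]
    exact List.length_pos_of_mem hp
  have h1 := h.2 (k - 1) (by omega)
  rw [Nat.sub_add_cancel hk] at h1
  have h2 : w.countP (fun p => p ≤ Y k) = w.length :=
    List.countP_le_length.antisymm (by rw [h.1]; exact h1)
  simpa using List.countP_eq_length.1 h2 p hp

/-- The sum over parking words as a sum over parking functions. -/
theorem parkingSum_eq (hy : ∀ i, 0 < y i) (l : Fin 2) :
    parkingSum (partialSum y) (partialSum y (n + 1)) (if l = 1 then {1} else ∅) n =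
      ∑ w ∈ (parkingFunctions_finite y).toFinset,
        Polynomial.X ^ (luckySet (∑ j, y j) l w).card *
          (1 + Polynomial.X) ^ (n - (luckySet (∑ j, y j) l w).card) := by
  classical
  have hY := strictMono_partialSum hy
  rw [parkingSum, wordSum_eq_sum_piFinset, ← Finset.sum_filter]
  refine Finset.sum_congr ?_ fun w hw => ?_
  · ext w
    rw [Finset.mem_filter, Fintype.mem_piFinset, Set.Finite.mem_toFinset, mem_parkingFunctions_iff]
    refine and_congr_left fun h => forall_congr' fun j => ?_
    -- The alphabet reaches up to `partialSum y (n + 1)`, but letters of parking words are at most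
    -- `partialSum y n`.
    rw [Finset.mem_Ioc, and_iff_left]
    · exact Iff.rfl
    · exact (h.le (by simp)).trans (hY.monotone (Nat.le_succ n))
  · rw [Set.Finite.mem_toFinset, mem_parkingFunctions_iff] at hw
    rw [← linearWeight_ofFn, sum_eq_partialSum]
    refine (linearWeight_eq_wordWeight (B := partialSum y (n + 1))
      (hY.monotone (Nat.le_succ n)) le_rfl _ (fun p hp => ⟨?_, hw.2.le hp⟩) _ _
      (fun _ _ => Iff.rfl) (hw.2.fits hY (by split_ifs <;> simp))).symm
    obtain ⟨j, rfl⟩ := (List.mem_ofFn' _ _).1 hp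
    exact hw.1 j

/-- The parameters of the blocks in the definition of `parkingPolynomial`. -/
noncomputable def blockParameter (y : Fin n → ℕ) (l : Fin 2) (i : ℕ) : ℝ[X] :=
  Polynomial.C (((if h : i < n then y ⟨i, h⟩ else 1 : ℕ) : ℝ)) * Polynomial.X +
    (if i + 1 = (l : ℕ) then 1 else 0)

/-- The delta can only sit in block `0`, so every nonempty partial sum contains it. -/
theorem sum_blockParameter (y : Fin n → ℕ) (l : Fin 2) (k : ℕ) :
    ∑ i ∈ Finset.range (k + 1), blockParameter y l i =
      (partialSum y (k + 1) : ℝ[X]) * Polynomial.X + ((l : ℕ) : ℝ[X]) := by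
  simp only [blockParameter, Finset.sum_add_distrib, ← Finset.sum_mul]
  congr 1
  · rw [partialSum, Nat.cast_sum]
    simp
  · fin_cases l <;> simp

theorem parkingPolynomial_eq_dominatingSum (y : Fin n → ℕ) (l : Fin 2) :
    parkingPolynomial y l = dominatingSum (blockParameter y l) n n := by
  classical
  rw [parkingPolynomial, dominatingSum, dominatingCompositions]
  refine Finset.sum_congr (Finset.filter_congr fun _ _ => Iff.rfl) fun s _ => ?_
  simp [blockParameter]

theorem card_blocked_zero (l : Fin 2) : (if l = 1 then {1} else ∅ : Finset ℕ).card = (l : ℕ) := by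
  fin_cases l <;> simp

theorem isMagicExpansion_parkingPolynomial (hy : ∀ i, 0 < y i) (l : Fin 2) :
    IsMagicExpansion (parkingPolynomial y l) fun i : Fin (n + 1) =>
      ((n.factorial : ℝ)⁻¹) * ((parkingFunctionsWithLucky y l i).ncard : ℝ) := by
  classical
  apply mul_left_cancel₀ (factorial_ne_zero_polynomial n)
  rw [parkingPolynomial_eq_dominatingSum, factorial_mul_dominatingSum (strictMono_partialSum hy)
    (Nat.lt_succ_self n) (U := if l = 1 then {1} else ∅) (by split_ifs <;> simp)
    (fun k => by rw [sum_blockParameter, card_blocked_zero]), parkingSum_eq hy]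
  have hcard (w : Fin n → ℕ) : (luckySet (∑ j, y j) l w).card < n + 1 := by
    simpa [Nat.lt_succ_iff] using Finset.card_le_univ (luckySet (∑ j, y j) l w)
  -- Group the parking functions by their number of lucky cars.
  rw [← Finset.sum_fiberwise_of_maps_to (t := Finset.univ)
    (g := fun w => (⟨_, hcard w⟩ : Fin (n + 1))) (fun _ _ => Finset.mem_univ _), Finset.mul_sum]
  refine Finset.sum_congr rfl fun i _ => ?_
  rw [Finset.sum_congr rfl fun w hw => by
    rw [show (luckySet (∑ j, y j) l w).card = i from congrArg Fin.val (Finset.mem_filter.1 hw).2],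
    Finset.sum_const, nsmul_eq_mul]
  have hset : parkingFunctionsWithLucky y l i =
      (((parkingFunctions_finite y).toFinset.filter fun w =>
        (⟨_, hcard w⟩ : Fin (n + 1)) = i : Finset (Fin n → ℕ)) : Set (Fin n → ℕ)) := by
    ext w
    simp [parkingFunctionsWithLucky, Fin.ext_iff]
  beta_reduce
  rw [hset, Set.ncard_coe_finset, ← mul_assoc, ← mul_assoc, ← mul_assoc]
  congr 2
  rw [← Polynomial.C_eq_natCast, ← Polynomial.C_eq_natCast, ← Polynomial.C_mul, ← mul_assoc,
    mul_inv_cancel₀ (by exact_mod_cast n.factorial_ne_zero), one_mul]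

/-- This sum is the leading coefficient; the constant word `1` is a parking function and makes it
positive. -/
theorem sum_ncard_parkingFunctionsWithLucky_pos (hy : ∀ i, 0 < y i) (l : Fin 2) :
    0 < ∑ i : Fin (n + 1),
      ((n.factorial : ℝ)⁻¹) * ((parkingFunctionsWithLucky y l i).ncard : ℝ) := by
  have hpos : (0 : ℝ) < (n.factorial : ℝ)⁻¹ := inv_pos.2 (by exact_mod_cast n.factorial_pos)
  have hcard : (luckySet (∑ j, y j) l (fun _ : Fin n => 1)).card < n + 1 := by
    simpa [Nat.lt_succ_iff] using Finset.card_le_univ (luckySet (∑ j, y j) l (fun _ : Fin n => 1))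
  refine Finset.sum_pos' (fun i _ => by positivity) ⟨⟨_, hcard⟩, Finset.mem_univ _, ?_⟩
  refine mul_pos hpos (Nat.cast_pos.2 ((Set.ncard_pos
    ((parkingFunctions_finite y).subset fun w hw => hw.1)).2 ⟨fun _ => 1, ?_, rfl⟩))
  refine ⟨fun _ => le_rfl, fun i => ?_⟩
  exact (hy i).trans_le (Finset.single_le_sum (fun j _ => Nat.zero_le (y j))
    (Finset.mem_Iic.2 le_rfl))

theorem parkingPolynomial_magic (hy : ∀ i, 0 < y i) (l : Fin 2) :
    (parkingPolynomial y l).natDegree = n ∧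
      (∃! c : Fin (n + 1) → ℝ, IsMagicExpansion (parkingPolynomial y l) c) ∧
      (∀ c : Fin (n + 1) → ℝ, IsMagicExpansion (parkingPolynomial y l) c → ∀ i : Fin (n + 1),
        (n.factorial : ℝ) * c i = ((parkingFunctionsWithLucky y l i).ncard : ℝ) ∧ 0 ≤ c i) ∧
      MagicPositive (parkingPolynomial y l) := by
  have h := isMagicExpansion_parkingPolynomial hy l
  have hdeg := h.natDegree (sum_ncard_parkingFunctionsWithLucky_pos hy l).ne'
  refine ⟨hdeg, ⟨_, h, fun c hc => hc.eq h⟩, fun c hc i => ?_, ?_⟩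
  · rw [hc.eq h]
    refine ⟨?_, by positivity⟩
    rw [← mul_assoc, mul_inv_cancel₀ (by exact_mod_cast n.factorial_ne_zero), one_mul]
  · rw [MagicPositive, hdeg]
    exact ⟨_, h, fun i => by positivity⟩

theorem isEhrhartPolynomial_parkingPolynomial (hy : ∀ i, 0 < y i) :
    IsEhrhartPolynomial (pitmanStanley y) (parkingPolynomial y 1) := by
  intro t ht
  obtain ⟨h1, h2⟩ := ncard_latticePoints_pitmanStanley y (sum_Iic_eq_partialSum y) ht
  refine ⟨h1, ?_⟩
  rw [h2, parkingPolynomial_eq_dominatingSum, eval_dominatingSum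
    (strictMono_partialSum hy).monotone fun k => by simp [sum_blockParameter]]

theorem IsEhrhartPolynomial.eq {P : Set (Fin n → ℝ)} {p q : ℝ[X]} (hp : IsEhrhartPolynomial P p)
    (hq : IsEhrhartPolynomial P q) : p = q := by
  refine Polynomial.eq_of_infinite_eval_eq p q
    ((Set.infinite_range_of_injective (f := fun k : ℕ => ((k + 1 : ℕ) : ℝ)) fun a b h => ?_).mono ?_)
  · simpa using h
  · rintro _ ⟨k, rfl⟩
    exact (hp (k + 1) k.succ_pos).2.trans (hq (k + 1) k.succ_pos).2.symm

end

theorem theorem1p1 (n : ℕ) (y : Fin n → ℕ) (hy : ∀ i, 0 < y i) :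
    -- the Ehrhart polynomial of the Pitman--Stanley polytope
    (∃! p : ℝ[X], IsEhrhartPolynomial (pitmanStanley y) p) ∧
    (∀ p : ℝ[X], IsEhrhartPolynomial (pitmanStanley y) p →
      p.natDegree = n ∧
      (∃! c : Fin (n + 1) → ℝ, IsMagicExpansion p c) ∧
      (∀ c : Fin (n + 1) → ℝ, IsMagicExpansion p c → ∀ i : Fin (n + 1),
        (n.factorial : ℝ) * c i = ((parkingFunctionsWithLucky y 1 i).ncard : ℝ) ∧ 0 ≤ c i) ∧
      MagicPositive p) ∧
    -- the polynomials attached to the protocols with `l = 0` and `l = 1`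
    (∀ l : Fin 2,
      (parkingPolynomial y l).natDegree = n ∧
      (∃! c : Fin (n + 1) → ℝ, IsMagicExpansion (parkingPolynomial y l) c) ∧
      (∀ c : Fin (n + 1) → ℝ, IsMagicExpansion (parkingPolynomial y l) c → ∀ i : Fin (n + 1),
        (n.factorial : ℝ) * c i = ((parkingFunctionsWithLucky y l i).ncard : ℝ) ∧ 0 ≤ c i) ∧
      MagicPositive (parkingPolynomial y l)) := by
  have hE := isEhrhartPolynomial_parkingPolynomial hy
  refine ⟨⟨_, hE, fun p hp => hp.eq hE⟩, fun p hp => ?_, parkingPolynomial_magic hy⟩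
  rw [hp.eq hE]
  exact parkingPolynomial_magic hy 1
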